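/- **Conventions.** $[n]=\{1,\dots,n\}$ with $n\ge 1$; intervals are intervals of integers; $\log=\log_2$. A length-$m$ monotone subsequence of $f$ is a tuple $i_1<\dots<i_m$ with $f(i_1)<\dots<f(i_m)$. For a set $T$ of tuples, $E(T)$ is the set of all indices occurring in tuples of $T$; tuples are disjoint if they share no index. **Splittable collections.** Let $T\subseteq I^{k_0}$ be a set of disjoint length-$k_0$ monotone subsequences of $f$ in an interval $I$, let $1\le c<k_0$, and let $T^{(L)}$, $T^{(R)}$ be the sets of length-$c$ prefixes and length-$(k_0-c)$ suffixes of tuples in $T$. The pair $(I,T)$ is $(c,\gamma,\beta)$-splittable if $|T|/|I|\ge\beta$; $f(i_c)<f(j_1)$ for all $(i_1,\dots,i_c)\in T^{(L)}$ and $(j_1,\dots,j_{k_0-c})\in T^{(R)}$; and $I$ has a partition into adjacent intervals $L,M,R$ (left to right), each of size at least $\gamma|I|$, with $T^{(L)}\subseteq L^c$ and $T^{(R)}\subseteq R^{k_0-c}$. Pairs $(I_h,T_h)$ with disjoint intervals $I_h$ form a $(c,\gamma,\beta)$-splittable collection of $T$ if each of them is $(c,\gamma,\beta)$-splittable and the $T_h$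 partition $T$. **Tree descriptors.** A $(k_0,\delta)$-weighted-tree $(G,\varrho)$ is a rooted binary tree $G$ with $k_0$ leaves, in which every internal node has a left and a right child, with labels $\varrho(v)\in\{1,\dots,\lceil\log(1/\delta)\rceil\}$ on its nodes. Its primary index $p\in[k_0]$ is the left-to-right rank of the leaf reached from the root by always moving to the child with more leaves below it (to the left child in case of a tie). Let $\mathsf I$ assign to each node a set of subintervals of $I$. Then $(G,\varrho,\mathsf I)$ is a $(k,k_0,\delta)$-tree descriptor representing $(f,T,I)$ if the following holds. * If $k_0=1$: $G$ is a single node $v$, $2^{-\varrho(v)}\le|T|/|I|\le2^{-\varrho(v)+1}$, and $\mathsf I(v)=\{\{t\}:t\in T\}$. * If $k_0>1$: let $v$ be the root, let $c$ be the number of leaves below its left child, and write $\mathsf I(v)=\{I_1,\dots,I_s\}$. The $I_h$ are disjoint, and with $T_h=T\cap I_h^{k_0}$ the pairs $(I_h,T_h)$ form a $(c,\frac1{6k},2^{-\varrho(v)})$-splittable collection of $T$ with $2^{-\varrho(v)}\sum_h|I_h|\ge|T|/\mathrm{poly}(k,\log(1/\delta))^k$. For each $h$ there is a partition $(L_h,M_h,R_h)$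 of $I_h$ as in the definition of splittable such that the left subtree with the map $u\mapsto\{J\in\mathsf I(u):J\subseteq L_h\}$ is a $(k,c,\delta)$-tree descriptor representing $(f,T_h^{(L)},L_h)$, and the right subtree with the map $u\mapsto\{J\in\mathsf I(u):J\subseteq R_h\}$ is a $(k,k_0-c,\delta)$-tree descriptor representing $(f,T_h^{(R)},R_h)$. Here $\mathrm{poly}$ is an arbitrary polynomial bound; none of the constants below depends on it. **Sampling procedures.** Let $B_{a,j}=[a-2^j,a+2^j]\cap[n]$, and let $m$ be the number of scales. $\texttt{Sample-Helper}^*(r,I,\rho,\mathcal I)$ includes each $a\in I\cap\bigcup\mathcal I$ in $\mathbf A_0$ independently with probability $\min(1,\frac1{\rho|I|})$. If $r=0$, it returns $(\mathbf A_0,\mathbf A_0)$. If $r>0$, then independently for all $a\in\mathbf A_0$ and $1\le j\le m$ it calls $\texttt{Sample-Helper}^*(r-1,B_{a,j},\rho,\mathcal I)$, and with $\mathbf R$ the union of the first components of the results it returns $((\mathbf A_0\cup\mathbf R)\cap I,\ \mathbf A_0\cap I)$. $\texttt{Sample-Helper}(r,I,\rho)$ is the same procedure without the restriction to $\bigcup\mathcal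 I$, and returns the first component only. $\texttt{Sample-Splittable}_k$ with parameters $\rho,q$ runs $\texttt{Sample-Helper}(\lfloor\log k\rfloor,[n],\rho)$ with $m=\lceil\log n\rceil$, gives up without querying if more than $q$ indices were sampled, and otherwise queries $f$ at all sampled indices and returns a length-$k$ monotone subsequence among them if there is one. **Theorem.** Let $k\ge1$. (a) There is a constant $C>0$, depending only on $k$, such that the following holds. Let $1\le k_0\le k$, $n\ge1$, $n\le2^m$, let $\alpha,\rho\in(0,1)$ satisfy $\alpha\ge C\rho$, and let $f:[n]\to\mathbb R$. Let $\mathcal I$ be a collection of disjoint intervals in $[n]$, and for each $I\in\mathcal I$ let $T_I\subseteq I^{k_0}$ be a set of disjoint length-$k_0$ monotone subsequences of $f$, with $\sum_{I\in\mathcal I}|T_I|\ge\alpha n/4$. Let $(G,\varrho)$ be a $(k_0,\alpha)$-weighted-tree such that for every $I\in\mathcal I$ there is a map $\mathsf I_I$ for which $(G,\varrho,\mathsf I_I)$ is a $(k,k_0,\alpha)$-tree descriptor representing $(f,T_I,I)$. Let $r\ge\lfloor\log k_0\rfloor$ and let $(\mathbf A,\mathbf A_0)$ be the output of $\texttt{Sample-Helper}^*(r,[n],\rho,\mathcal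 I)$ with $m$ scales. Then with probability at least $1-\frac{k_0}{100k}$ there are indices $i_1,\dots,i_{k_0}$ such that 1. $(i_1,\dots,i_{k_0})$ is a length-$k_0$ monotone subsequence of $f$; 2. there is $I\in\mathcal I$ with $i_1,\dots,i_{k_0}\in I\cap E(T_I)$; 3. $i_1,\dots,i_{k_0}\in\mathbf A$ and $i_p\in\mathbf A_0$, where $p$ is the primary index of $(G,\varrho)$. (b) Write $\mathrm{polylog}_A(1/\varepsilon)=A(\log(2/\varepsilon))^A$. For every integer $A\ge1$ there are a natural number $B$ and parameters $\rho=\rho(\varepsilon)\in(0,1)$ and $q=q(n,\varepsilon)\in\mathbb N$ (all also depending on $k$) such that for all $n\ge1$ and $0<\varepsilon\le1$ the non-adaptive randomized algorithm $\texttt{Sample-Splittable}_k$ with these parameters always makes at most $$\frac1\varepsilon\Bigl(\frac{\log n}{\varepsilon}\Bigr)^{\lfloor\log_2k\rfloor}\mathrm{polylog}_B(1/\varepsilon)$$ queries, all in $[n]$. Moreover, for every $f:[n]\to\mathbb R$ for which there are a set $T\subseteq[n]^k$ of disjoint length-$k$ monotone subsequences of $f$ with $|T|\ge\varepsilon n/\mathrm{polylog}_A(1/\varepsilon)$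 and a $(k,k,\alpha)$-tree descriptor representing $(f,T,[n])$ with $\alpha\in(0,1)$ and $\alpha\ge\varepsilon/\mathrm{polylog}_A(1/\varepsilon)$, it outputs a length-$k$ monotone subsequence of $f$ with probability at least $9/10$. -/

import Mathlib

open scoped ENNReal

namespace MonotoneSampling

noncomputable section

/-! ### Tuples, intervals

A tuple of indices is a list of natural numbers, `[n]` is `Finset.Icc 1 n`, and a sequence
`f : [n] → ℝ` is a function on `ℕ` of which only the values on `[n]` are ever used. -/

/-- The tuple `l` is a monotone (increasing) subsequence of `f`. -/
def IsMonoSubseq (f : ℕ → ℝ) (l : List ℕ) : Prop :=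
  l.Pairwise (fun a b => a < b ∧ f a < f b)

/-- `T ⊆ I ^ k₀` is a set of disjoint, length-`k₀` monotone subsequences of `f`. -/
def IsTupleFamily (f : ℕ → ℝ) (k₀ : ℕ) (I : Finset ℕ) (T : Finset (List ℕ)) : Prop :=
  (∀ l ∈ T, l.length = k₀ ∧ (∀ x ∈ l, x ∈ I) ∧ IsMonoSubseq f l) ∧
    (T : Set (List ℕ)).Pairwise List.Disjoint

/-- `E(T)`, the set of all indices that occur in tuples of `T`. -/
def indices (T : Finset (List ℕ)) : Finset ℕ := T.biUnion List.toFinset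

/-- The set of prefixes of length `c` of tuples in `T`. -/
def prefixes (c : ℕ) (T : Finset (List ℕ)) : Finset (List ℕ) := T.image (List.take c)

/-- The set of suffixes that remain when the first `c` entries of tuples in `T` are removed. -/
def suffixes (c : ℕ) (T : Finset (List ℕ)) : Finset (List ℕ) := T.image (List.drop c)

/-- The tuples of `T` all of whose entries lie in `J`. -/
def restrict (T : Finset (List ℕ)) (J : Finset ℕ) : Finset (List ℕ) :=
  T.filter (fun l => ∀ x ∈ l, x ∈ J)

def IsInterval (S : Finset ℕ) : Prop := ∃ a b : ℕ, S = Finset.Icc a b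

/-! ### Splittable intervals -/

/-- `L, M, R` is a partition of `I` into three adjacent intervals, in this order, each of size at
least `γ |I|`, such that the `c`-prefixes of `T` lie in `L` and the complementary suffixes
lie in `R`. -/
def IsSplitPartition (c : ℕ) (γ : ℝ) (I : Finset ℕ) (T : Finset (List ℕ))
    (L M R : Finset ℕ) : Prop :=
  (IsInterval L ∧ IsInterval M ∧ IsInterval R) ∧
  L ∪ M ∪ R = I ∧
  (∀ x ∈ L, ∀ y ∈ M, x < y) ∧ (∀ x ∈ M, ∀ y ∈ R, x < y) ∧ (∀ x ∈ L, ∀ y ∈ R, x < y) ∧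
  (γ * I.card ≤ L.card ∧ γ * I.card ≤ M.card ∧ γ * I.card ≤ R.card) ∧
  (∀ l ∈ prefixes c T, ∀ x ∈ l, x ∈ L) ∧
  (∀ l ∈ suffixes c T, ∀ x ∈ l, x ∈ R)

/-- The pair `(I, T)` is `(c, γ, β)`-splittable. -/
def IsSplittable (f : ℕ → ℝ) (c : ℕ) (γ β : ℝ) (I : Finset ℕ) (T : Finset (List ℕ)) : Prop :=
  β ≤ (T.card : ℝ) / I.card ∧
  (∀ l ∈ prefixes c T, ∀ l' ∈ suffixes c T, ∀ x ∈ l.getLast?, ∀ y ∈ l'.head?, f x < f y) ∧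
  ∃ L M R : Finset ℕ, IsSplitPartition c γ I T L M R

/-- For a collection `𝓙` of disjoint intervals, the pairs `(J, T ∩ J ^ k₀)`, `J ∈ 𝓙`, form a
`(c, γ, β)`-splittable collection of `T`. -/
def IsSplittableCollection (f : ℕ → ℝ) (c : ℕ) (γ β : ℝ) (𝓙 : Finset (Finset ℕ))
    (T : Finset (List ℕ)) : Prop :=
  (𝓙 : Set (Finset ℕ)).PairwiseDisjoint id ∧
  (∀ J ∈ 𝓙, IsInterval J ∧ IsSplittable f c γ β J (restrict T J)) ∧
  (𝓙 : Set (Finset ℕ)).PairwiseDisjoint (restrict T) ∧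
  𝓙.biUnion (restrict T) = T

/-! ### Tree descriptors -/

/-- A rooted ordered binary tree `G` with a label `ϱ(v)` at each node `v`; the first child of
an internal node is the left one, and the order `≤_G` on the leaves is from left to right. -/
inductive WTree : Type
  | leaf (w : ℕ) : WTree
  | node (w : ℕ) (l r : WTree) : WTree

/-- The number of leaves. -/
def WTree.leaves : WTree → ℕ
  | .leaf _ => 1
  | .node _ l r => l.leaves + r.leaves

/-- The nodes, given by their root-to-node paths (`false` is left, `true` is right). -/
def WTree.nodes : WTree → Finset (List Bool)
  | .leaf _ => {[]}
  | .node _ l r =>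
      insert [] (l.nodes.image (List.cons false) ∪ r.nodes.image (List.cons true))

/-- All labels lie in `{1, ..., N}`. -/
def WTree.LabelsIn (N : ℕ) : WTree → Prop
  | .leaf w => 1 ≤ w ∧ w ≤ N
  | .node w l r => (1 ≤ w ∧ w ≤ N) ∧ l.LabelsIn N ∧ r.LabelsIn N

/-- The rank (counted from `1`) of the leaf reached from the root by always moving to the child
with more leaves below it, and to the left child in case of a tie. -/
def WTree.primaryIndex : WTree → ℕ
  | .leaf _ => 1
  | .node _ l r =>
      if r.leaves ≤ l.leaves then l.primaryIndex else l.leaves + r.primaryIndex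

/-- `t` is a `(k₀, δ)`-weighted-tree. -/
def IsWeightedTree (k₀ : ℕ) (δ : ℝ) (t : WTree) : Prop :=
  t.leaves = k₀ ∧ t.LabelsIn ⌈Real.logb 2 (1 / δ)⌉₊

/-- The recursive part of the definition of a tree descriptor. The number `K` is the value of
`poly(k, log (1/δ)) ^ k`, and a map `ivl` on the nodes is a map on root-to-node paths. -/
def DescriptorRec (f : ℕ → ℝ) (k : ℕ) (K : ℝ) :
    WTree → (List Bool → Finset (Finset ℕ)) → Finset (List ℕ) → Finset ℕ → Prop
  | .leaf w, ivl, T, I =>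
      (2 : ℝ) ^ (-(w : ℤ)) ≤ (T.card : ℝ) / I.card ∧
      (T.card : ℝ) / I.card ≤ (2 : ℝ) ^ (-(w : ℤ) + 1) ∧
      ivl [] = T.image List.toFinset
  | .node w l r, ivl, T, I =>
      (∀ J ∈ ivl [], J ⊆ I) ∧
      IsSplittableCollection f l.leaves (1 / (6 * k)) ((2 : ℝ) ^ (-(w : ℤ))) (ivl []) T ∧
      (T.card : ℝ) ≤ K * ((2 : ℝ) ^ (-(w : ℤ)) * ∑ J ∈ ivl [], (J.card : ℝ)) ∧
      ∀ J ∈ ivl [], ∃ L M R : Finset ℕ,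
        IsSplitPartition l.leaves (1 / (6 * k)) J (restrict T J) L M R ∧
        DescriptorRec f k K l (fun v => (ivl (false :: v)).filter (· ⊆ L))
          (prefixes l.leaves (restrict T J)) L ∧
        DescriptorRec f k K r (fun v => (ivl (true :: v)).filter (· ⊆ R))
          (suffixes l.leaves (restrict T J)) R

/-- `(t, ivl)` is a `(k, k₀, δ)`-tree descriptor that represents `(f, T, I)`, where the factor
`poly(k, log (1/δ)) ^ k` is `(d * (k + log (1/δ)) ^ d) ^ k`. As `d` grows, these factors exceed
every polynomial in `k` and `log (1/δ)`. -/
def IsTreeDescriptor (d : ℕ) (f : ℕ → ℝ) (k k₀ : ℕ) (δ : ℝ) (t : WTree)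
    (ivl : List Bool → Finset (Finset ℕ)) (T : Finset (List ℕ)) (I : Finset ℕ) : Prop :=
  IsInterval I ∧ IsTupleFamily f k₀ I T ∧ IsWeightedTree k₀ δ t ∧
  (∀ v ∈ t.nodes, ∀ J ∈ ivl v, IsInterval J ∧ J ⊆ I) ∧
  DescriptorRec f k ((d * (k + Real.logb 2 (1 / δ)) ^ d) ^ k) t ivl T I

/-! ### The sampling procedures -/

/-- A biased coin that shows `true` with probability `min 1 p`. -/
def coin (p : ℝ) : PMF Bool :=
  PMF.ofFintype (fun b => bif b then min 1 (ENNReal.ofReal p) else 1 - min 1 (ENNReal.ofReal p))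
    (by simp)

/-- The union of independent random sets `X i`, one for each entry `i` of the list. -/
def indepUnion {ι : Type} (X : ι → PMF (Finset ℕ)) : List ι → PMF (Finset ℕ)
  | [] => PMF.pure ∅
  | i :: is => (X i).bind fun A => (indepUnion X is).bind fun B => PMF.pure (A ∪ B)

/-- The random subset of `S` that contains each element independently with probability
`min 1 p`. -/
def randomSubset (S : Finset ℕ) (p : ℝ) : PMF (Finset ℕ) :=
  indepUnion (fun a => (coin p).map fun b => bif b then {a} else ∅) (S.sort (· ≤ ·))

/-- The interval `B_{a,j} = [a - 2 ^ j, a + 2 ^ j]` of `[n]`. -/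
def ball (n a j : ℕ) : Finset ℕ := Finset.Icc (a - 2 ^ j) (a + 2 ^ j) ∩ Finset.Icc 1 n

/-- The pairs `(a, j)` with `a ∈ A₀` and `j ∈ {1, ..., m}`. -/
def scalePairs (m : ℕ) (A₀ : Finset ℕ) : List (ℕ × ℕ) :=
  (A₀.sort (· ≤ ·)).product (List.range' 1 m)

/-- `Sample-Helper(r, I, ρ)`, with `m` scales. -/
def sampleHelper (n m : ℕ) (ρ : ℝ) : ℕ → Finset ℕ → PMF (Finset ℕ)
  | 0, I => randomSubset I (1 / (ρ * I.card))
  | r + 1, I =>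
      (randomSubset I (1 / (ρ * I.card))).bind fun A₀ =>
        (indepUnion (fun x => sampleHelper n m ρ r (ball n x.1 x.2)) (scalePairs m A₀)).bind
          fun A => PMF.pure ((A₀ ∪ A) ∩ I)

/-- `Sample-Helper*(r, I, ρ, 𝓘)`, with `m` scales; the output is the pair `(A, A₀)`, where `A₀`
consists of the elements that are sampled in the first round and `A` of all sampled elements. -/
def sampleHelperStar (n m : ℕ) (ρ : ℝ) (𝓘 : Finset (Finset ℕ)) :
    ℕ → Finset ℕ → PMF (Finset ℕ × Finset ℕ)
  | 0, I =>
      (randomSubset (I.filter fun a => ∃ J ∈ 𝓘, a ∈ J) (1 / (ρ * I.card))).map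
        fun A₀ => (A₀, A₀)
  | r + 1, I =>
      (randomSubset (I.filter fun a => ∃ J ∈ 𝓘, a ∈ J) (1 / (ρ * I.card))).bind fun A₀ =>
        (indepUnion (fun x => (sampleHelperStar n m ρ 𝓘 r (ball n x.1 x.2)).map Prod.fst)
          (scalePairs m A₀)).bind
          fun A => PMF.pure ((A₀ ∪ A) ∩ I, A₀ ∩ I)

/-! ### Non-adaptive algorithms -/

/-- A non-adaptive randomized algorithm: a random set of queries, drawn without access to the
sequence, and an output computed from the queries and the answers (`none` means failure). -/
structure NonadaptiveAlgorithm where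
  queries : PMF (Finset ℕ)
  output : (Q : Finset ℕ) → (Q → ℝ) → Option (List ℕ)

/-- The probability that the output is a length-`k` monotone subsequence of `f : [n] → ℝ`. -/
def NonadaptiveAlgorithm.successProb (𝒜 : NonadaptiveAlgorithm) (k n : ℕ) (f : ℕ → ℝ) : ℝ≥0∞ :=
  𝒜.queries.toOuterMeasure {Q | ∃ l : List ℕ, 𝒜.output Q (fun x => f x) = some l ∧
    l.length = k ∧ (∀ x ∈ l, x ∈ Finset.Icc 1 n) ∧ IsMonoSubseq f l}

open Classical in
/-- `Sample-Splittable_k` with parameters `ρ` and `q`: run `Sample-Helper(⌊log₂ k⌋, [n], ρ)` with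
`⌈log₂ n⌉` scales, give up if more than `q` indices were sampled, otherwise query all of them and
return a length-`k` monotone subsequence among them if there is one. -/
def sampleSplittable (k n : ℕ) (ρ : ℝ) (q : ℕ) : NonadaptiveAlgorithm where
  queries := (sampleHelper n (Nat.clog 2 n) ρ (Nat.log 2 k) (Finset.Icc 1 n)).map
    fun A => if A.card ≤ q then A else ∅
  output := fun Q v =>
    if h : ∃ l : List Q, l.length = k ∧ l.Pairwise (fun a b => a < b ∧ v a < v b) then
      some (h.choose.map Subtype.val)
    else none

/-- `polylog(1/ε)`, in the form `A (log₂ (2/ε)) ^ A`. -/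
def polylog (A : ℕ) (ε : ℝ) : ℝ := A * Real.logb 2 (2 / ε) ^ A

end

end MonotoneSampling

open MonotoneSampling

namespace MonotoneSampling

noncomputable section

/-! ### Expectations -/

/-! The proof of (a) is an induction on the tree (`findsWithHighProb`). The failure probability
allowed is 1/(100k) per leaf. At a leaf, the tuples are single points making up a fraction at least
100kρ of the domain D, each sampled with probability min(1, 1/(ρ|D|)), so the first round misses
them all with probability at most 1/(100k) (`expect_firstRound_hit`).

At an internal node, cut every tuple into its prefix and suffix and let P be the side belonging to
the subtree with more leaves. The P-parts are as numerous as the tuples, so by induction one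
monotone P-part is found inside some splittable interval J, with its primary entry a in the first
round. One scale j gives a ball around a that contains J and has at most 4|J| elements. The other
parts have density at least α/2 in J, hence at least α/8 ≥ 100kρ in the ball, so by induction the
recursive call on this ball finds one of them. The smaller subtree has at most half of the leaves,
so one round less suffices for it. Splittability makes any prefix found in J and any suffix found in
J concatenate to a monotone tuple, even if they come from different tuples.

The two searches use the same random sample. They are decoupled by superposition: let U be the union
of all P-sides. Keeping only points of U, and independently keeping only points outside U in the
calls around the same first-round points, yields a random set stochastically dominated by the true
sample (`expect_restricted_superposition`). As the event sought is monotone, the success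
probabilities multiply (`eventProb_superposition`).

For (b), the recursion for the expected sample size and Markov's inequality bound the probability of
giving up by 1/20, while (a)'s induction finds a tuple with probability 99/100. -/

/-- The expectation of a nonnegative function of a discrete random variable. -/
def expect {α : Type*} (p : PMF α) (g : α → ℝ≥0∞) : ℝ≥0∞ := ∑' a, p a * g a

section Expect

variable {α β : Type*}

lemma expect_pure (a : α) (g : α → ℝ≥0∞) : expect (PMF.pure a) g = g a := by
  classical
  rw [expect, tsum_eq_single a]
  · simp
  · intro b hb
    simp [PMF.pure_apply, hb]

lemma expect_bind (p : PMF α) (q : α → PMF β) (g : β → ℝ≥0∞) :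
    expect (p.bind q) g = expect p fun a => expect (q a) g := by
  simp only [expect, PMF.bind_apply, ← ENNReal.tsum_mul_right, ← ENNReal.tsum_mul_left]
  rw [ENNReal.tsum_comm]
  simp only [mul_assoc]

lemma expect_map (p : PMF α) (h : α → β) (g : β → ℝ≥0∞) :
    expect (p.map h) g = expect p fun a => g (h a) := by
  rw [PMF.map, expect_bind]
  simp only [Function.comp_apply, expect_pure]

lemma expect_comm (p : PMF α) (q : PMF β) (g : α → β → ℝ≥0∞) :
    (expect p fun a => expect q fun b => g a b) = expect q fun b => expect p fun a => g a b := by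
  simp only [expect, ← ENNReal.tsum_mul_left]
  rw [ENNReal.tsum_comm]
  simp only [mul_left_comm]

lemma expect_mono_of_support {p : PMF α} {g g' : α → ℝ≥0∞} (h : ∀ a ∈ p.support, g a ≤ g' a) :
    expect p g ≤ expect p g' := by
  refine ENNReal.tsum_le_tsum fun a => ?_
  by_cases ha : p a = 0
  · simp [ha]
  · exact mul_le_mul_right (h a ((PMF.mem_support_iff p a).2 ha)) _

lemma expect_congr_of_support {p : PMF α} {g g' : α → ℝ≥0∞} (h : ∀ a ∈ p.support, g a = g' a) :
    expect p g = expect p g' :=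
  le_antisymm (expect_mono_of_support fun a ha => (h a ha).le)
    (expect_mono_of_support fun a ha => (h a ha).ge)

lemma expect_mono (p : PMF α) {g g' : α → ℝ≥0∞} (h : ∀ a, g a ≤ g' a) :
    expect p g ≤ expect p g' :=
  expect_mono_of_support fun a _ => h a

lemma expect_const (p : PMF α) (c : ℝ≥0∞) : (expect p fun _ => c) = c := by
  rw [expect, ENNReal.tsum_mul_right, p.tsum_coe, one_mul]

lemma expect_add (p : PMF α) (g g' : α → ℝ≥0∞) :
    (expect p fun a => g a + g' a) = expect p g + expect p g' := by
  simp only [expect, mul_add, ENNReal.tsum_add]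

lemma expect_mul_const (p : PMF α) (g : α → ℝ≥0∞) (c : ℝ≥0∞) :
    (expect p fun a => g a * c) = expect p g * c := by
  simp only [expect, ← mul_assoc, ENNReal.tsum_mul_right]

lemma toOuterMeasure_eq_expect (p : PMF α) (s : Set α) :
    p.toOuterMeasure s = expect p (s.indicator 1) := by
  rw [PMF.toOuterMeasure_apply, expect]
  refine tsum_congr fun a => ?_
  by_cases ha : a ∈ s <;> simp [ha]

lemma expect_markov (p : PMF α) (X : α → ℝ≥0∞) {c : ℝ≥0∞} (hc : c ≠ 0) (hc' : c ≠ ⊤) :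
    expect p ({a | c ≤ X a}.indicator 1) ≤ expect p X / c := by
  rw [ENNReal.le_div_iff_mul_le (Or.inl hc) (Or.inl hc'), ← expect_mul_const]
  refine expect_mono p fun a => ?_
  by_cases ha : c ≤ X a <;> simp [ha]

end Expect

/-! ### Independent unions -/

/-- Random finite sets form a commutative monoid under independent union. -/
instance independentUnionMonoid : CommMonoid (PMF (Finset ℕ)) where
  mul p q := p.bind fun A => q.bind fun B => PMF.pure (A ∪ B)
  one := PMF.pure ∅
  mul_assoc p q s := by
    change PMF.bind (PMF.bind p _) _ = PMF.bind p _
    simp only [PMF.bind_bind, PMF.pure_bind, Finset.union_assoc]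
    congr 1; funext A
    change _ = PMF.bind (PMF.bind q _) _
    simp only [PMF.bind_bind, PMF.pure_bind]
  one_mul p := by
    change PMF.bind (PMF.pure ∅) _ = p
    simp only [PMF.pure_bind, Finset.empty_union, PMF.bind_pure]
  mul_one p := by
    change PMF.bind p (fun A => PMF.bind (PMF.pure ∅) _) = p
    simp only [PMF.pure_bind, Finset.union_empty, PMF.bind_pure]
  mul_comm p q := by
    change PMF.bind p _ = PMF.bind q _
    rw [PMF.bind_comm]
    simp only [Finset.union_comm]

lemma expect_one (g : Finset ℕ → ℝ≥0∞) : expect 1 g = g ∅ := expect_pure _ _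

lemma expect_mul (p q : PMF (Finset ℕ)) (g : Finset ℕ → ℝ≥0∞) :
    expect (p * q) g = expect p fun A => expect q fun B => g (A ∪ B) := by
  change expect (PMF.bind p _) g = _
  simp only [expect_bind, expect_pure]

/-- Turns lists into products in a commutative monoid, so that splitting an index set or a factor
becomes ordinary `Finset.prod` algebra. -/
lemma indepUnion_eq_prod {ι : Type} (X : ι → PMF (Finset ℕ)) (l : List ι) :
    indepUnion X l = (l.map X).prod := by
  induction l with
  | nil => rfl
  | cons i is ih =>
    rw [List.map_cons, List.prod_cons, ← ih]
    rfl

lemma randomSubset_eq_prod (S : Finset ℕ) (p : ℝ) :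
    randomSubset S p = ∏ a ∈ S, (coin p).map fun b => bif b then {a} else ∅ := by
  rw [randomSubset, indepUnion_eq_prod, ← List.prod_toFinset _ (Finset.sort_nodup S (· ≤ ·)),
    Finset.sort_toFinset]

lemma indepUnion_scalePairs (X : ℕ × ℕ → PMF (Finset ℕ)) (m : ℕ) (A : Finset ℕ) :
    indepUnion X (scalePairs m A) = ∏ x ∈ A ×ˢ Finset.Icc 1 m, X x := by
  have hnd : (scalePairs m A).Nodup :=
    List.Nodup.product (Finset.sort_nodup A (· ≤ ·)) (List.nodup_range' )
  rw [indepUnion_eq_prod, ← List.prod_toFinset _ hnd]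
  refine Finset.prod_congr ?_ fun _ _ => rfl
  ext ⟨a, j⟩
  have h : (a, j) ∈ scalePairs m A ↔ a ∈ A.sort (· ≤ ·) ∧ j ∈ List.range' 1 m :=
    List.pair_mem_product
  rw [List.mem_toFinset, h, Finset.mem_sort, List.mem_range'_1, Finset.mem_product,
    Finset.mem_Icc]
  exact and_congr_right fun _ => by lia

lemma subset_of_mem_support_randomSubset {S A : Finset ℕ} {p : ℝ}
    (h : A ∈ (randomSubset S p).support) : A ⊆ S := by
  rw [randomSubset_eq_prod] at h
  induction S using Finset.induction_on generalizing A with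
  | empty =>
    rw [Finset.prod_empty] at h
    have : A = ∅ := by
      have h' : A ∈ (PMF.pure ∅ : PMF (Finset ℕ)).support := h
      simpa using h'
    simp [this]
  | insert a S ha ih =>
    rw [Finset.prod_insert ha] at h
    have h' : A ∈ (PMF.bind ((coin p).map fun b => bif b then {a} else ∅) fun A =>
      PMF.bind (∏ a ∈ S, (coin p).map fun b => bif b then {a} else ∅)
        fun B => PMF.pure (A ∪ B)).support := h
    simp only [PMF.mem_support_bind_iff, PMF.mem_support_pure_iff] at h'
    obtain ⟨B, hB, B', hB', rfl⟩ := h'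
    refine Finset.union_subset ?_ ((ih hB').trans (Finset.subset_insert a S))
    rw [PMF.mem_support_map_iff] at hB
    obtain ⟨b, -, rfl⟩ := hB
    cases b <;> simp

/-- Independence. The intended `g` is the indicator of missing a fixed set, which is multiplicative
under unions. -/
lemma expect_prod_of_multiplicative {ι : Type*} (X : ι → PMF (Finset ℕ)) (S : Finset ι)
    {g : Finset ℕ → ℝ≥0∞} (h0 : g ∅ = 1) (hg : ∀ A B, g (A ∪ B) = g A * g B) :
    expect (∏ i ∈ S, X i) g = ∏ i ∈ S, expect (X i) g := by
  classical
  induction S using Finset.induction_on with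
  | empty => rw [Finset.prod_empty, Finset.prod_empty, expect_one, h0]
  | insert a S ha ih =>
    rw [Finset.prod_insert ha, Finset.prod_insert ha, expect_mul, ← ih, ← expect_mul_const]
    congr 1; funext A
    rw [mul_comm, ← expect_mul_const]
    congr 1; funext B
    rw [hg, mul_comm]

lemma expect_card_prod_le {ι : Type*} (X : ι → PMF (Finset ℕ)) (S : Finset ι) :
    (expect (∏ i ∈ S, X i) fun A => (A.card : ℝ≥0∞)) ≤
      ∑ i ∈ S, expect (X i) fun A => (A.card : ℝ≥0∞) := by
  classical
  induction S using Finset.induction_on with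
  | empty => simp [expect_one]
  | insert a S ha ih =>
    rw [Finset.prod_insert ha, Finset.sum_insert ha, expect_mul]
    calc _ ≤ expect (X a) fun A => expect (∏ i ∈ S, X i) fun B =>
            ((A.card : ℝ≥0∞) + (B.card : ℝ≥0∞)) := by
          refine expect_mono _ fun A => expect_mono _ fun B => ?_
          exact_mod_cast Finset.card_union_le A B
      _ = (expect (X a) fun A => (A.card : ℝ≥0∞)) +
            expect (∏ i ∈ S, X i) fun B => (B.card : ℝ≥0∞) := by
          simp only [expect_add, expect_const]
      _ ≤ _ := by gcongr

lemma expect_coin_map (p : ℝ) (a : ℕ) (g : Finset ℕ → ℝ≥0∞) :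
    expect ((coin p).map fun b => bif b then {a} else ∅) g =
      min 1 (ENNReal.ofReal p) * g {a} + (1 - min 1 (ENNReal.ofReal p)) * g ∅ := by
  rw [expect_map, expect, tsum_fintype, Fintype.sum_bool]
  simp [coin]

/-! ### Stochastic domination -/

/-- The random set `q` stochastically dominates `p`. -/
def StochLE (p q : PMF (Finset ℕ)) : Prop :=
  ∀ g : Finset ℕ → ℝ≥0∞, Monotone g → expect p g ≤ expect q g

lemma StochLE.refl (p : PMF (Finset ℕ)) : StochLE p p := fun _ _ => le_rfl

lemma StochLE.trans {p q s : PMF (Finset ℕ)} (h : StochLE p q) (h' : StochLE q s) :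
    StochLE p s := fun g hg => (h g hg).trans (h' g hg)

/-- Replace one factor at a time: with the other set fixed, a monotone function of the union is
still monotone, so no coupling is needed. -/
lemma StochLE.mul {p p' q q' : PMF (Finset ℕ)} (hp : StochLE p p') (hq : StochLE q q') :
    StochLE (p * q) (p' * q') := by
  intro g hg
  rw [expect_mul, expect_mul]
  calc _ ≤ expect p fun A => expect q' fun B => g (A ∪ B) :=
        expect_mono _ fun A => hq _ fun B B' h => hg (Finset.union_subset_union_right h)
    _ ≤ _ := hp _ fun A A' h => expect_mono _ fun B => hg (Finset.union_subset_union_left h)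

lemma one_stochLE (p : PMF (Finset ℕ)) : StochLE 1 p := by
  intro g hg
  rw [expect_one]
  calc g ∅ = expect p fun _ => g ∅ := (expect_const _ _).symm
    _ ≤ _ := expect_mono _ fun A => hg (Finset.empty_subset A)

lemma stochLE_mul_right (p q : PMF (Finset ℕ)) : StochLE p (p * q) := by
  simpa using (StochLE.refl p).mul (one_stochLE q)

lemma stochLE_mul_left (p q : PMF (Finset ℕ)) : StochLE p (q * p) := by
  simpa using (one_stochLE q).mul (StochLE.refl p)

lemma stochLE_prod {ι : Type*} {X Y : ι → PMF (Finset ℕ)} (S : Finset ι)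
    (h : ∀ i ∈ S, StochLE (X i) (Y i)) : StochLE (∏ i ∈ S, X i) (∏ i ∈ S, Y i) := by
  classical
  induction S using Finset.induction_on with
  | empty => exact StochLE.refl _
  | insert a S ha ih =>
    rw [Finset.prod_insert ha, Finset.prod_insert ha]
    exact (h a (Finset.mem_insert_self a S)).mul
      (ih fun i hi => h i (Finset.mem_insert_of_mem hi))

lemma stochLE_prod_of_subset {ι : Type*} (X : ι → PMF (Finset ℕ)) {S S' : Finset ι}
    (h : S ⊆ S') : StochLE (∏ i ∈ S, X i) (∏ i ∈ S', X i) := by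
  classical
  rw [← Finset.prod_sdiff h]
  exact stochLE_mul_left _ _

lemma stochLE_prod_of_mem {ι : Type*} (X : ι → PMF (Finset ℕ)) {S : Finset ι} {i : ι}
    (h : i ∈ S) : StochLE (X i) (∏ i ∈ S, X i) := by
  simpa using stochLE_prod_of_subset X (Finset.singleton_subset_iff.2 h)

/-! ### The sampling procedure, restricted to a set -/

/-- The elements sampled from `D` in the first round, when only elements of `U` are kept. -/
def firstRound (ρ : ℝ) (U D : Finset ℕ) : PMF (Finset ℕ) :=
  randomSubset (D ∩ U) (1 / (ρ * D.card))

/-- The elements sampled by the recursive calls (of depth less than `r`) around the elements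
of `A`, when only elements of `U` are kept. -/
def extension (n m : ℕ) (ρ : ℝ) (U : Finset ℕ) : ℕ → Finset ℕ → PMF (Finset ℕ)
  | 0, _ => 1
  | r + 1, A => ∏ x ∈ A ×ˢ Finset.Icc 1 m,
      (firstRound ρ U (ball n x.1 x.2)).bind fun A₀ =>
        (extension n m ρ U r A₀).map fun R => (A₀ ∪ R) ∩ ball n x.1 x.2

/-- All elements sampled from `D`, when only elements of `U` are kept. -/
def restrictedSample (n m : ℕ) (ρ : ℝ) (U : Finset ℕ) (r : ℕ) (D : Finset ℕ) :
    PMF (Finset ℕ) :=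
  (firstRound ρ U D).bind fun A₀ => (extension n m ρ U r A₀).map fun R => (A₀ ∪ R) ∩ D

variable {n m : ℕ} {ρ : ℝ}

lemma extension_succ (U : Finset ℕ) (r : ℕ) (A : Finset ℕ) :
    extension n m ρ U (r + 1) A =
      ∏ x ∈ A ×ˢ Finset.Icc 1 m, restrictedSample n m ρ U r (ball n x.1 x.2) := rfl

lemma expect_restrictedSample (U : Finset ℕ) (r : ℕ) (D : Finset ℕ) (g : Finset ℕ → ℝ≥0∞) :
    expect (restrictedSample n m ρ U r D) g =
      expect (firstRound ρ U D) fun A₀ =>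
        expect (extension n m ρ U r A₀) fun R => g ((A₀ ∪ R) ∩ D) := by
  simp only [restrictedSample, expect_bind, expect_map]

lemma subset_of_mem_support_firstRound {U D A : Finset ℕ}
    (h : A ∈ (firstRound ρ U D).support) : A ⊆ D ∩ U :=
  subset_of_mem_support_randomSubset h

/-- The bias of a coin depends on `D` alone, not on the set of points that are kept; hence
restrictions to disjoint sets are independent. -/
lemma firstRound_union {U V : Finset ℕ} (h : Disjoint U V) (D : Finset ℕ) :
    firstRound ρ (U ∪ V) D = firstRound ρ U D * firstRound ρ V D := by
  rw [firstRound, firstRound, firstRound, randomSubset_eq_prod, randomSubset_eq_prod,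
    randomSubset_eq_prod, Finset.inter_union_distrib_left, Finset.prod_union]
  exact h.mono Finset.inter_subset_right Finset.inter_subset_right

lemma filter_mem_family (𝓘 : Finset (Finset ℕ)) (D : Finset ℕ) :
    (D.filter fun a => ∃ J ∈ 𝓘, a ∈ J) = D ∩ 𝓘.biUnion id := by
  ext a; simp

lemma sampleHelperStar_fst (𝓘 : Finset (Finset ℕ)) (r : ℕ) (D : Finset ℕ) :
    (sampleHelperStar n m ρ 𝓘 r D).map Prod.fst =
      restrictedSample n m ρ (𝓘.biUnion id) r D := by
  induction r generalizing D with
  | zero =>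
    rw [sampleHelperStar, PMF.map_comp, filter_mem_family, restrictedSample]
    change PMF.map id (firstRound ρ (𝓘.biUnion id) D) = _
    rw [PMF.map_id]
    conv_lhs => rw [← PMF.bind_pure (firstRound ρ (𝓘.biUnion id) D)]
    ext B
    simp only [PMF.bind_apply]
    -- The extra intersection with `D` in `restrictedSample` changes nothing on the support.
    refine tsum_congr fun A => ?_
    by_cases hA : A ∈ (firstRound ρ (𝓘.biUnion id) D).support
    · have h1 : A ∩ D = A := Finset.inter_eq_left.2
        ((subset_of_mem_support_firstRound hA).trans Finset.inter_subset_left)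
      change _ = _ * (PMF.map _ (PMF.pure ∅)) B
      rw [PMF.pure_map, Finset.union_empty, h1]
    · rw [(PMF.apply_eq_zero_iff _ _).2 hA, zero_mul, zero_mul]
  | succ r ih =>
    rw [sampleHelperStar, restrictedSample, PMF.map_bind, filter_mem_family]
    change PMF.bind (firstRound ρ (𝓘.biUnion id) D) _ = _
    congr 1; funext A₀
    simp only [PMF.map_bind, PMF.pure_map, ih, indepUnion_scalePairs, ← extension_succ]
    rfl

lemma expect_sampleHelperStar (𝓘 : Finset (Finset ℕ)) (r : ℕ) (D : Finset ℕ)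
    (g : Finset ℕ × Finset ℕ → ℝ≥0∞) :
    expect (sampleHelperStar n m ρ 𝓘 r D) g =
      expect (firstRound ρ (𝓘.biUnion id) D) fun A₀ =>
        expect (extension n m ρ (𝓘.biUnion id) r A₀) fun R => g ((A₀ ∪ R) ∩ D, A₀) := by
  have hs : ∀ A ∈ (firstRound ρ (𝓘.biUnion id) D).support, A ∩ D = A := fun A hA =>
    Finset.inter_eq_left.2
      ((subset_of_mem_support_firstRound hA).trans Finset.inter_subset_left)
  cases r with
  | zero =>
    rw [sampleHelperStar, expect_map, filter_mem_family]
    change expect (firstRound ρ (𝓘.biUnion id) D) _ = _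
    refine expect_congr_of_support fun A hA => ?_
    change _ = expect 1 _
    rw [expect_one, Finset.union_empty, hs A hA]
  | succ r =>
    rw [sampleHelperStar, expect_bind, filter_mem_family]
    change expect (firstRound ρ (𝓘.biUnion id) D) _ = _
    refine expect_congr_of_support fun A hA => ?_
    simp only [expect_bind, expect_pure, indepUnion_scalePairs, hs A hA,
      sampleHelperStar_fst, ← extension_succ]

lemma ball_subset (n a j : ℕ) : ball n a j ⊆ Finset.Icc 1 n := Finset.inter_subset_right

/-- The unrestricted procedure is the starred one for the family consisting of `[n]` alone, so one
analysis serves both. -/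
lemma sampleHelper_eq_restrictedSample (r : ℕ) {D : Finset ℕ} (hD : D ⊆ Finset.Icc 1 n) :
    sampleHelper n m ρ r D = restrictedSample n m ρ (Finset.Icc 1 n) r D := by
  have hf : ∀ D ⊆ Finset.Icc 1 n,
      D ∩ ({Finset.Icc 1 n} : Finset (Finset ℕ)).biUnion id = D := fun D hD => by
    rw [Finset.singleton_biUnion, id, Finset.inter_eq_left.2 hD]
  have key : ∀ r, ∀ D ⊆ Finset.Icc 1 n, sampleHelper n m ρ r D =
      (sampleHelperStar n m ρ {Finset.Icc 1 n} r D).map Prod.fst := by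
    intro r
    induction r with
    | zero =>
      intro D hD
      rw [sampleHelper, sampleHelperStar, PMF.map_comp, filter_mem_family, hf D hD]
      exact (PMF.map_id _).symm
    | succ r ih =>
      intro D hD
      rw [sampleHelper, sampleHelperStar, filter_mem_family, hf D hD]
      simp only [PMF.map_bind, PMF.pure_map]
      congr 1; funext A₀
      congr 2; funext x
      exact ih _ (ball_subset _ _ _)
  rw [key r D hD, sampleHelperStar_fst, Finset.singleton_biUnion, id]

/-! ### Superposition of restricted samples -/

/-- One half of an induction on depth: domination for the recursive calls gives domination for a
whole sample. The hypothesis `ih` is supplied by `extension_union_stochLE`. -/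
lemma restrictedSample_mul_stochLE {r : ℕ}
    (ih : ∀ U V A B : Finset ℕ, Disjoint U V → Disjoint A B →
      StochLE (extension n m ρ U r A * extension n m ρ V r B)
        (extension n m ρ (U ∪ V) r (A ∪ B)))
    {U V : Finset ℕ} (h : Disjoint U V) (D : Finset ℕ) :
    StochLE (restrictedSample n m ρ U r D * restrictedSample n m ρ V r D)
      (restrictedSample n m ρ (U ∪ V) r D) := by
  intro g hg
  rw [expect_mul, expect_restrictedSample, expect_restrictedSample, firstRound_union h,
    expect_mul]
  refine expect_mono_of_support fun A hA => ?_
  simp only [expect_restrictedSample]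
  rw [expect_comm]
  refine expect_mono_of_support fun B hB => ?_
  have hAB : Disjoint A B := h.mono
    ((subset_of_mem_support_firstRound hA).trans Finset.inter_subset_right)
    ((subset_of_mem_support_firstRound hB).trans Finset.inter_subset_right)
  refine le_trans (le_of_eq ?_) (ih U V A B h hAB (fun R => g ((A ∪ B ∪ R) ∩ D))
    fun R R' hR => hg (Finset.inter_subset_inter_right (Finset.union_subset_union_right hR)))
  rw [expect_mul]
  congr 1; funext R
  congr 1; funext R'
  congr 1
  ext x
  simp only [Finset.mem_union, Finset.mem_inter]
  tauto

lemma restrictedSample_stochLE_of_superposition {r : ℕ} {U W : Finset ℕ} {D : Finset ℕ}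
    (h : ∀ U V : Finset ℕ, Disjoint U V →
      StochLE (restrictedSample n m ρ U r D * restrictedSample n m ρ V r D)
        (restrictedSample n m ρ (U ∪ V) r D)) (hUW : U ⊆ W) :
    StochLE (restrictedSample n m ρ U r D) (restrictedSample n m ρ W r D) := by
  have h1 := h U (W \ U) Finset.disjoint_sdiff
  rw [Finset.union_sdiff_of_subset hUW] at h1
  exact (stochLE_mul_right _ _).trans h1

/-- Since `A` and `B` are disjoint, the left side uses different calls of the right side. Only
domination holds, as the right side also explores `V` around `A` and `U` around `B`. -/
lemma extension_union_stochLE (r : ℕ) : ∀ U V A B : Finset ℕ, Disjoint U V → Disjoint A B →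
    StochLE (extension n m ρ U r A * extension n m ρ V r B)
      (extension n m ρ (U ∪ V) r (A ∪ B)) := by
  induction r with
  | zero =>
    intro U V A B _ _
    change StochLE (1 * 1) 1
    rw [one_mul]
    exact StochLE.refl _
  | succ r ih =>
    intro U V A B hUV hAB
    rw [extension_succ, extension_succ, extension_succ, Finset.union_product, Finset.prod_union]
    · exact (stochLE_prod _ fun x _ => restrictedSample_stochLE_of_superposition
        (fun U V h => restrictedSample_mul_stochLE ih h _) Finset.subset_union_left).mul
        (stochLE_prod _ fun x _ => restrictedSample_stochLE_of_superposition
        (fun U V h => restrictedSample_mul_stochLE ih h _) Finset.subset_union_right)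
    · exact Finset.disjoint_product.2 (Or.inl hAB)

/-- Here both explorations start from the same points: each single call on `U ∪ V` is split into its
`U`-part and its `V`-part. This is what lets a point found in `U` trigger a search outside `U`. -/
lemma extension_mul_stochLE {U V : Finset ℕ} (h : Disjoint U V) (r : ℕ) (A : Finset ℕ) :
    StochLE (extension n m ρ U r A * extension n m ρ V r A)
      (extension n m ρ (U ∪ V) r A) := by
  cases r with
  | zero =>
    change StochLE (1 * 1) 1
    rw [one_mul]
    exact StochLE.refl _
  | succ r =>
    rw [extension_succ, extension_succ, extension_succ, ← Finset.prod_mul_distrib]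
    exact stochLE_prod _ fun x _ =>
      restrictedSample_mul_stochLE (extension_union_stochLE r) h _

lemma extension_stochLE_of_subset (U : Finset ℕ) (r : ℕ) {A B : Finset ℕ} (h : A ⊆ B) :
    StochLE (extension n m ρ U r A) (extension n m ρ U r B) := by
  cases r with
  | zero => exact StochLE.refl _
  | succ r => exact stochLE_prod_of_subset _ (Finset.product_subset_product_left h)

/-- Restricting the sample to `U` and adding an independent sample restricted to `W \ U` in the
recursive calls produces at most as much as the sample restricted to `W`. -/
lemma expect_restricted_superposition {U W : Finset ℕ} (hUW : U ⊆ W) (r : ℕ) (D : Finset ℕ)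
    {g : Finset ℕ → Finset ℕ → ℝ≥0∞}
    (hg : ∀ A A' B B', A ⊆ A' → B ⊆ B' → g A B ≤ g A' B') :
    (expect (firstRound ρ U D) fun A₀ => expect (extension n m ρ U r A₀) fun R =>
      expect (extension n m ρ (W \ U) r A₀) fun R' => g ((A₀ ∪ R ∪ R') ∩ D) A₀) ≤
    expect (firstRound ρ W D) fun A₀ => expect (extension n m ρ W r A₀) fun R =>
      g ((A₀ ∪ R) ∩ D) A₀ := by
  have hd : Disjoint U (W \ U) := Finset.disjoint_sdiff
  have hu : U ∪ W \ U = W := Finset.union_sdiff_of_subset hUW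
  have h1 : firstRound ρ W D = firstRound ρ U D * firstRound ρ (W \ U) D := by
    rw [← firstRound_union hd, hu]
  rw [h1, expect_mul]
  refine expect_mono _ fun A => ?_
  -- The left side ignores the first-round points `B` outside `U`. Averaging over them is harmless,
  -- and on the right they only add starting points.
  rw [← expect_const (firstRound ρ (W \ U) D) (expect (extension n m ρ U r A) _)]
  refine expect_mono _ fun B => ?_
  have h2 := (extension_mul_stochLE (n := n) (m := m) (ρ := ρ) hd r A).trans
    (extension_stochLE_of_subset (U ∪ W \ U) r (Finset.subset_union_left (s₂ := B)))
  rw [hu] at h2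
  refine le_trans ?_ (h2 _ fun R R' hR => hg _ _ _ _
    (Finset.inter_subset_inter_right (Finset.union_subset_union_right hR)) subset_rfl)
  rw [expect_mul]
  refine expect_mono _ fun R => expect_mono _ fun R' => hg _ _ _ _ ?_ Finset.subset_union_left
  intro x
  simp only [Finset.mem_union, Finset.mem_inter]
  tauto

/-! ### The size of the sample -/

/-- A bound on the expected number of elements sampled in `r + 1` rounds. -/
def sizeBound (m : ℕ) (ρ : ℝ) : ℕ → ℝ
  | 0 => 1 / ρ
  | r + 1 => 1 / ρ * (1 + m * sizeBound m ρ r)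

lemma sizeBound_nonneg (m : ℕ) (hρ : 0 < ρ) (r : ℕ) : 0 ≤ sizeBound m ρ r := by
  induction r with
  | zero => simp only [sizeBound]; positivity
  | succ r ih => simp only [sizeBound]; positivity

lemma expect_card_firstRound_le (hρ : 0 < ρ) (U D : Finset ℕ) :
    (expect (firstRound ρ U D) fun A => (A.card : ℝ≥0∞)) ≤ ENNReal.ofReal (1 / ρ) := by
  rw [firstRound, randomSubset_eq_prod]
  refine (expect_card_prod_le _ _).trans ?_
  calc _ ≤ ∑ i ∈ D ∩ U, ENNReal.ofReal (1 / (ρ * D.card)) := by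
        refine Finset.sum_le_sum fun i _ => ?_
        rw [expect_coin_map]
        simp
    _ ≤ ∑ i ∈ D, ENNReal.ofReal (1 / (ρ * D.card)) :=
        Finset.sum_le_sum_of_subset Finset.inter_subset_left
    _ ≤ _ := by
        rw [Finset.sum_const, nsmul_eq_mul, ← ENNReal.ofReal_natCast,
          ← ENNReal.ofReal_mul (by positivity)]
        refine ENNReal.ofReal_le_ofReal ?_
        rcases Nat.eq_zero_or_pos D.card with h | h
        · rw [h]; simpa using hρ.le
        · have : (0 : ℝ) < D.card := by exact_mod_cast h
          refine le_of_eq ?_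
          field_simp

/-- At most 1/ρ points are expected in the first round, and each of them makes `m` calls of one
level less. -/
lemma expect_card_restrictedSample_le (hρ : 0 < ρ) (U : Finset ℕ) (r : ℕ) (D : Finset ℕ) :
    (expect (restrictedSample n m ρ U r D) fun A => (A.card : ℝ≥0∞)) ≤
      ENNReal.ofReal (sizeBound m ρ r) := by
  have hcard : ∀ A R D : Finset ℕ, (((A ∪ R) ∩ D).card : ℝ≥0∞) ≤ (A.card : ℝ≥0∞) + R.card := by
    intro A R D
    exact_mod_cast (Finset.card_le_card Finset.inter_subset_left).trans (Finset.card_union_le A R)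
  induction r generalizing D with
  | zero =>
    rw [expect_restrictedSample]
    refine le_trans (expect_mono _ fun A => ?_) (expect_card_firstRound_le hρ U D)
    change expect 1 _ ≤ _
    rw [expect_one]
    simpa using hcard A ∅ D
  | succ r ih =>
    rw [expect_restrictedSample]
    have hb := sizeBound_nonneg m hρ r
    have key : ∀ A : Finset ℕ, (expect (extension n m ρ U (r + 1) A) fun R =>
        (((A ∪ R) ∩ D).card : ℝ≥0∞)) ≤
          (A.card : ℝ≥0∞) * ENNReal.ofReal (1 + m * sizeBound m ρ r) := by
      intro A
      calc _ ≤ expect (extension n m ρ U (r + 1) A) fun R => (A.card : ℝ≥0∞) + R.card :=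
            expect_mono _ fun R => hcard A R D
        _ = A.card + expect (extension n m ρ U (r + 1) A) fun R => (R.card : ℝ≥0∞) := by
            rw [expect_add, expect_const]
        _ ≤ A.card + ∑ x ∈ A ×ˢ Finset.Icc 1 m, ENNReal.ofReal (sizeBound m ρ r) := by
            gcongr
            rw [extension_succ]
            exact (expect_card_prod_le _ _).trans (Finset.sum_le_sum fun x _ => ih _)
        _ = _ := by
            rw [Finset.sum_const, Finset.card_product, Nat.card_Icc, nsmul_eq_mul,
              ENNReal.ofReal_add zero_le_one (by positivity),
              ENNReal.ofReal_mul (by positivity), ENNReal.ofReal_one, ENNReal.ofReal_natCast,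
              mul_add, mul_one]
            push_cast
            rw [mul_assoc]
    calc _ ≤ expect (firstRound ρ U D) fun A =>
            (A.card : ℝ≥0∞) * ENNReal.ofReal (1 + m * sizeBound m ρ r) := expect_mono _ key
      _ = (expect (firstRound ρ U D) fun A => (A.card : ℝ≥0∞)) *
            ENNReal.ofReal (1 + m * sizeBound m ρ r) := expect_mul_const _ _ _
      _ ≤ ENNReal.ofReal (1 / ρ) * ENNReal.ofReal (1 + m * sizeBound m ρ r) := by
            gcongr
            exact expect_card_firstRound_le hρ U D
      _ = _ := by rw [← ENNReal.ofReal_mul (by positivity), sizeBound]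

/-! ### Hitting a set in the first round -/

/-- A rational substitute for the exponential tail, from Bernoulli's inequality and (1 - q)(1 + q) ≤
1. It suffices because only failure 1/c is needed for c expected hits. -/
lemma one_sub_pow_le_inv {q : ℝ} (h0 : 0 ≤ q) (h1 : q ≤ 1) (N : ℕ) :
    (1 - q) ^ N * (1 + N * q) ≤ 1 := by
  calc (1 - q) ^ N * (1 + N * q) ≤ (1 - q) ^ N * (1 + q) ^ N := by
        exact mul_le_mul_of_nonneg_left (one_add_mul_le_pow (by linarith) N)
          (pow_nonneg (by linarith) N)
    _ = (1 - q ^ 2) ^ N := by rw [← mul_pow]; ring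
    _ ≤ 1 := pow_le_one₀ (by nlinarith) (by nlinarith)

lemma expect_firstRound_hit {U D E : Finset ℕ} (hE : E ⊆ D ∩ U) (hρ : 0 < ρ) (hD : D.Nonempty)
    {c : ℝ} (hc : 0 < c) (hcard : c * ρ * D.card ≤ E.card) :
    ENNReal.ofReal (1 - 1 / c) ≤
      expect (firstRound ρ U D) ({A | ∃ a ∈ E, a ∈ A}.indicator 1) := by
  set p : ℝ := 1 / (ρ * D.card) with hp
  have hDc : (0 : ℝ) < D.card := by exact_mod_cast hD.card_pos
  have hp0 : 0 < p := by positivity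
  have hEpos : 0 < E.card := by
    have : (0 : ℝ) < E.card := lt_of_lt_of_le (by positivity) hcard
    exact_mod_cast this
  set q : ℝ := min 1 p with hq
  have hq0 : 0 ≤ q := le_min zero_le_one hp0.le
  have hq1 : q ≤ 1 := min_le_left _ _
  have hpq : min 1 (ENNReal.ofReal p) = ENNReal.ofReal q := by
    rw [hq, ENNReal.ofReal_min, ENNReal.ofReal_one]
  have hmiss : expect (firstRound ρ U D) ({A | Disjoint E A}.indicator 1) =
      ENNReal.ofReal ((1 - q) ^ E.card) := by
    rw [firstRound, randomSubset_eq_prod, expect_prod_of_multiplicative]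
    · rw [← Finset.prod_sdiff hE, Finset.prod_eq_one, one_mul,
        Finset.prod_congr rfl (g := fun _ => ENNReal.ofReal (1 - q)), Finset.prod_const,
        ENNReal.ofReal_pow (by linarith)]
      · intro a ha
        rw [expect_coin_map, ← hp, hpq]
        simp [ha, ENNReal.ofReal_sub _ hq0]
      · intro a ha
        have ha' : a ∉ E := (Finset.mem_sdiff.1 ha).2
        rw [expect_coin_map, ← hp, hpq]
        simp only [Set.indicator, Set.mem_ofPred_eq, Finset.disjoint_singleton_right, ha',
          not_false_eq_true, if_true, Finset.disjoint_empty_right, Pi.one_apply, mul_one]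
        exact add_tsub_cancel_of_le (by simpa using hq1)
    · simp
    · intro A B
      by_cases hA : Disjoint E A <;> by_cases hB : Disjoint E B <;>
        simp [hA, hB]
  have hbound : (1 - q) ^ E.card ≤ 1 / c := by
    -- If 1/(ρ|D|) ≥ 1 the coins are certain and, `E` being nonempty, it is never missed.
    rcases le_total 1 p with h | h
    · have : q = 1 := by rw [hq, min_eq_left h]
      rw [this, sub_self, zero_pow hEpos.ne']
      positivity
    · have hqp : q = p := by rw [hq, min_eq_right h]
      have h2 := one_sub_pow_le_inv hq0 hq1 E.card
      have h3 : c ≤ E.card * q := by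
        rw [hqp, hp, mul_one_div, le_div_iff₀ (by positivity)]
        linarith
      rw [le_div_iff₀ hc]
      have h4 : 0 ≤ (1 - q) ^ E.card := pow_nonneg (by linarith) _
      nlinarith
  have hsum : expect (firstRound ρ U D) ({A | ∃ a ∈ E, a ∈ A}.indicator 1) +
      expect (firstRound ρ U D) ({A | Disjoint E A}.indicator 1) = 1 := by
    rw [← expect_add, ← expect_const (firstRound ρ U D) 1]
    congr 1; funext A
    by_cases h : ∃ a ∈ E, a ∈ A
    · have : ¬ Disjoint E A := Finset.not_disjoint_iff.2 h
      rw [Set.indicator_of_mem (by exact h), Set.indicator_of_notMem (by exact this)]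
      simp
    · have : Disjoint E A := by
        by_contra h'
        exact h (Finset.not_disjoint_iff.1 h')
      rw [Set.indicator_of_notMem (by exact h), Set.indicator_of_mem (by exact this)]
      simp
  rw [hmiss] at hsum
  rw [ENNReal.ofReal_sub _ (by positivity), ENNReal.ofReal_one, tsub_le_iff_right, ← hsum]
  gcongr

/-! ### Families of tuples -/

lemma mem_indices {T : Finset (List ℕ)} {x : ℕ} : x ∈ indices T ↔ ∃ l ∈ T, x ∈ l := by
  simp [indices]

lemma IsTupleFamily.restrict {f : ℕ → ℝ} {k₀ : ℕ} {I : Finset ℕ} {T : Finset (List ℕ)}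
    (h : IsTupleFamily f k₀ I T) (J : Finset ℕ) : IsTupleFamily f k₀ J (restrict T J) := by
  constructor
  · intro l hl
    rw [MonotoneSampling.restrict, Finset.mem_filter] at hl
    exact ⟨(h.1 l hl.1).1, hl.2, (h.1 l hl.1).2.2⟩
  · exact h.2.mono fun l hl => (Finset.mem_filter.1 hl).1

lemma IsTupleFamily.image {f : ℕ → ℝ} {k₀ c : ℕ} {I J : Finset ℕ} {T : Finset (List ℕ)}
    (h : IsTupleFamily f k₀ I T) {φ : List ℕ → List ℕ} (hφ : ∀ l, (φ l).Sublist l)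
    (hlen : ∀ l, l.length = k₀ → (φ l).length = c) (hJ : ∀ l ∈ T.image φ, ∀ x ∈ l, x ∈ J) :
    IsTupleFamily f c J (T.image φ) := by
  constructor
  · intro l hl
    refine ⟨?_, hJ l hl, ?_⟩ <;> obtain ⟨l, hl', rfl⟩ := Finset.mem_image.1 hl
    · exact hlen l (h.1 l hl').1
    · exact (h.1 l hl').2.2.sublist (hφ l)
  · intro l hl l' hl' hne
    obtain ⟨a, ha, rfl⟩ := Finset.mem_image.1 (Finset.mem_coe.1 hl)
    obtain ⟨b, hb, rfl⟩ := Finset.mem_image.1 (Finset.mem_coe.1 hl')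
    have hab : a ≠ b := fun h => hne (h ▸ rfl)
    intro x hx hx'
    exact h.2 ha hb hab ((hφ a).subset hx) ((hφ b).subset hx')

/-- Different tuples are disjoint, so their nonempty sublists cannot coincide; `0 < c` excludes the
empty sublist. -/
lemma IsTupleFamily.card_image {f : ℕ → ℝ} {k₀ c : ℕ} {I : Finset ℕ} {T : Finset (List ℕ)}
    (h : IsTupleFamily f k₀ I T) {φ : List ℕ → List ℕ} (hφ : ∀ l, (φ l).Sublist l)
    (hlen : ∀ l, l.length = k₀ → (φ l).length = c) (hc : 0 < c) :
    (T.image φ).card = T.card := by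
  refine Finset.card_image_of_injOn fun a ha b hb hab => ?_
  by_contra hne
  have hl := hlen a (h.1 a ha).1
  obtain ⟨x, hx⟩ := List.exists_mem_of_length_pos (l := φ a) (by omega)
  exact h.2 ha hb hne ((hφ a).subset hx) ((hφ b).subset (by simpa only [← hab] using hx))

lemma IsTupleFamily.card_le_indices {f : ℕ → ℝ} {k₀ : ℕ} {I : Finset ℕ} {T : Finset (List ℕ)}
    (h : IsTupleFamily f k₀ I T) (hk : 0 < k₀) : T.card ≤ (indices T).card := by
  rw [indices, Finset.card_biUnion, Finset.card_eq_sum_ones]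
  · refine Finset.sum_le_sum fun l hl => ?_
    obtain ⟨x, hx⟩ := List.exists_mem_of_length_pos (l := l) (by rw [(h.1 l hl).1]; exact hk)
    exact Finset.card_pos.2 ⟨x, List.mem_toFinset.2 hx⟩
  · intro a ha b hb hab
    exact List.disjoint_toFinset_iff_disjoint.2 (h.2 ha hb hab)

lemma IsTupleFamily.indices_subset {f : ℕ → ℝ} {k₀ : ℕ} {I : Finset ℕ} {T : Finset (List ℕ)}
    (h : IsTupleFamily f k₀ I T) : indices T ⊆ I := by
  intro x hx
  obtain ⟨l, hl, hxl⟩ := mem_indices.1 hx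
  exact (h.1 l hl).2.1 x hxl

/-- Splittability compares only last entries of prefixes with first entries of suffixes.
Monotonicity within tuples extends this to all indices, as needed when entries of several tuples are
recombined. -/
lemma lt_of_mem_prefixes_of_mem_suffixes {f : ℕ → ℝ} {k₀ c : ℕ} {I : Finset ℕ}
    {T : Finset (List ℕ)} (h : IsTupleFamily f k₀ I T)
    (hs : ∀ l ∈ prefixes c T, ∀ l' ∈ suffixes c T, ∀ x ∈ l.getLast?, ∀ y ∈ l'.head?, f x < f y)
    {x y : ℕ} (hx : x ∈ indices (prefixes c T)) (hy : y ∈ indices (suffixes c T)) :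
    f x < f y := by
  obtain ⟨l, hl, hxl⟩ := mem_indices.1 hx
  obtain ⟨l', hl', hyl⟩ := mem_indices.1 hy
  have hm : IsMonoSubseq f l := by
    obtain ⟨a, ha, rfl⟩ := Finset.mem_image.1 hl
    exact (h.1 a ha).2.2.sublist (List.take_sublist c a)
  have hm' : IsMonoSubseq f l' := by
    obtain ⟨a, ha, rfl⟩ := Finset.mem_image.1 hl'
    exact (h.1 a ha).2.2.sublist (List.drop_sublist c a)
  have hz := hs l hl l' hl'
  have h1 : ∃ z ∈ l.getLast?, f x ≤ f z := by
    have hne := List.ne_nil_of_mem hxl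
    refine ⟨l.getLast hne, by simp [List.getLast?_eq_some_getLast hne], ?_⟩
    rw [← List.dropLast_append_getLast hne] at hm hxl
    rcases List.mem_append.1 hxl with hx' | hx'
    · exact ((List.pairwise_append.1 hm).2.2 x hx' _ (by simp)).2.le
    · rw [List.mem_singleton.1 hx']
  have h2 : ∃ z ∈ l'.head?, f z ≤ f y := by
    cases l' with
    | nil => simp at hyl
    | cons z l' =>
      refine ⟨z, by simp, ?_⟩
      rcases List.mem_cons.1 hyl with rfl | hy'
      · exact le_rfl
      · exact ((List.pairwise_cons.1 hm').1 y hy').2.le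
  obtain ⟨z, hz1, hz2⟩ := h1
  obtain ⟨z', hz1', hz2'⟩ := h2
  exact hz2.trans_lt ((hz z hz1 z' hz1').trans_le hz2')

/-! ### Trees -/

lemma WTree.leaves_pos (t : WTree) : 0 < t.leaves := by
  induction t with
  | leaf w => simp [WTree.leaves]
  | node w l r ihl ihr => simp only [WTree.leaves]; omega

lemma WTree.primaryIndex_pos (t : WTree) : 0 < t.primaryIndex := by
  induction t with
  | leaf w => simp [WTree.primaryIndex]
  | node w l r ihl ihr => simp only [WTree.primaryIndex]; split <;> omega

/-- Rounding log(1/α) up costs less than one unit in the exponent, hence the factor 2. -/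
lemma half_le_two_zpow_neg {α : ℝ} (hα : 0 < α) {w : ℕ} (hw : 1 ≤ w)
    (h : w ≤ ⌈Real.logb 2 (1 / α)⌉₊) : α / 2 ≤ (2 : ℝ) ^ (-(w : ℤ)) := by
  have hpos : 0 < ⌈Real.logb 2 (1 / α)⌉₊ := by omega
  have hlog : 0 < Real.logb 2 (1 / α) := Nat.ceil_pos.1 hpos
  have h1 : (w : ℝ) < Real.logb 2 (1 / α) + 1 :=
    (Nat.cast_le.2 h).trans_lt (Nat.ceil_lt_add_one hlog.le)
  have h2 : (2 : ℝ) ^ ((w : ℝ) - 1) ≤ 1 / α := by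
    calc (2 : ℝ) ^ ((w : ℝ) - 1) ≤ 2 ^ Real.logb 2 (1 / α) :=
          Real.rpow_le_rpow_of_exponent_le one_le_two (by linarith)
      _ = 1 / α := Real.rpow_logb two_pos (by norm_num) (by positivity)
  rw [Real.rpow_sub two_pos, Real.rpow_natCast, Real.rpow_one, div_le_div_iff₀ two_pos hα] at h2
  rw [zpow_neg, zpow_natCast, div_le_iff₀ two_pos, inv_mul_eq_div, le_div_iff₀ (by positivity)]
  linarith

/-! ### Balls -/

/-- Take the least j with 2^j ≥ |J|. Then 2^j ≤ 2|J| - 2, so the ball has at most 2·2^j + 1 ≤ 4|J|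
points; `2 ≤ J.card` guarantees j ≥ 1. -/
lemma exists_ball_of_isInterval {J : Finset ℕ} (hJ : IsInterval J) (hJn : J ⊆ Finset.Icc 1 n)
    (hn : n ≤ 2 ^ m) {x : ℕ} (hx : x ∈ J) (h2 : 2 ≤ J.card) :
    ∃ j ∈ Finset.Icc 1 m, J ⊆ ball n x j ∧ (ball n x j).card ≤ 4 * J.card := by
  have hcard : J.card ≤ n := by simpa using Finset.card_le_card hJn
  set j := Nat.clog 2 J.card with hj
  have hj1 : J.card ≤ 2 ^ j := Nat.le_pow_clog one_lt_two _
  have hj0 : 1 ≤ j := Nat.clog_pos one_lt_two h2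
  have hj2 : 2 ^ (j - 1) < J.card := Nat.pow_pred_clog_lt_self one_lt_two h2
  have hj3 : 2 ^ j = 2 * 2 ^ (j - 1) := by
    conv_lhs => rw [show j = (j - 1) + 1 by omega, pow_succ, mul_comm]
  refine ⟨j, Finset.mem_Icc.2 ⟨hj0, (Nat.clog_le_iff_le_pow one_lt_two).2 (hcard.trans hn)⟩,
    ?_, ?_⟩
  · obtain ⟨a, b, rfl⟩ := hJ
    intro y hy
    refine Finset.mem_inter.2 ⟨?_, hJn hy⟩
    simp only [Finset.mem_Icc, Nat.card_Icc] at *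
    omega
  · calc (ball n x j).card ≤ (Finset.Icc (x - 2 ^ j) (x + 2 ^ j)).card :=
          Finset.card_le_card Finset.inter_subset_left
      _ ≤ 4 * J.card := by
          rw [Nat.card_Icc]
          omega

/-! ### Events of the restricted sampling procedure -/

/-- The probability that the restricted sampling procedure has the property `F`, which may depend
on the set of all sampled elements and on the set of those sampled in the first round. -/
def eventProb (n m : ℕ) (ρ : ℝ) (W : Finset ℕ) (r : ℕ) (D : Finset ℕ)
    (F : Finset ℕ → Finset ℕ → Prop) : ℝ≥0∞ :=
  expect (firstRound ρ W D) fun A₀ => expect (extension n m ρ W r A₀) fun R =>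
    {B | F B A₀}.indicator 1 ((A₀ ∪ R) ∩ D)

lemma indicator_mono {α β : Type*} {s : Set α} {s' : Set β} {a : α} {b : β}
    (h : a ∈ s → b ∈ s') : s.indicator (1 : α → ℝ≥0∞) a ≤ s'.indicator 1 b := by
  by_cases ha : a ∈ s
  · rw [Set.indicator_of_mem ha, Set.indicator_of_mem (h ha)]; rfl
  · rw [Set.indicator_of_notMem ha]; exact zero_le

/-- If the restriction to `U` has the property `F` with probability at least `a`, and in this case
there is a recursive call whose restriction to `W \ U` leads to `G` with probability at least `b`,
then the restriction to `W` has the property `G` with probability at least `a * b`. -/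
lemma eventProb_superposition {U W D : Finset ℕ} (hUW : U ⊆ W) {r : ℕ}
    {F G : Finset ℕ → Finset ℕ → Prop}
    (hG : ∀ A A' B B', A ⊆ A' → B ⊆ B' → G A B → G A' B') {a b : ℝ≥0∞}
    (ha : a ≤ eventProb n m ρ U (r + 1) D F)
    (hb : ∀ A A₀, F A A₀ → ∃ x ∈ A₀, ∃ j ∈ Finset.Icc 1 m,
      b ≤ expect (restrictedSample n m ρ (W \ U) r (ball n x j))
        ({B | G (A ∪ B ∩ D) A₀}.indicator 1)) :
    a * b ≤ eventProb n m ρ W (r + 1) D G := by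
  refine le_trans ?_ (expect_restricted_superposition hUW (r + 1) D
    (g := fun A B => {A | G A B}.indicator 1 A)
    fun A A' B B' hA hB => indicator_mono (hG A A' B B' hA hB))
  calc a * b ≤ eventProb n m ρ U (r + 1) D F * b := by gcongr
    _ ≤ _ := by
      rw [eventProb, ← expect_mul_const]
      refine expect_mono _ fun A₀ => ?_
      rw [← expect_mul_const]
      refine expect_mono _ fun R => ?_
      by_cases hF : F ((A₀ ∪ R) ∩ D) A₀
      · obtain ⟨x, hx, j, hj, h⟩ := hb _ _ hF
        rw [Set.indicator_of_mem (by exact hF), Pi.one_apply, one_mul]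
        -- Of all the calls around `A₀` only the one at `(x, j)` is needed; the others merely
        -- enlarge the sample.
        refine h.trans ?_
        have h1 := stochLE_prod_of_mem
          (fun x : ℕ × ℕ => restrictedSample n m ρ (W \ U) r (ball n x.1 x.2))
          (Finset.mem_product.2 ⟨hx, hj⟩ : (x, j) ∈ A₀ ×ˢ Finset.Icc 1 m)
        refine (h1 _ fun B B' hB => indicator_mono (hG _ _ _ _
          (Finset.union_subset_union_right (Finset.inter_subset_inter_right hB))
          subset_rfl)).trans ?_
        rw [extension_succ]
        refine expect_mono _ fun B => indicator_mono (hG _ _ _ _ ?_ subset_rfl)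
        intro y
        simp only [Finset.mem_union, Finset.mem_inter]
        tauto
      · rw [Set.indicator_of_notMem (by exact hF), zero_mul]
        exact zero_le

/-! ### The main induction -/

/-- The sample `A` contains a monotone subsequence of length `k₀` from one of the families `T i`,
whose `p`-th entry was sampled in the first round. -/
def Finds {ι : Type} (f : ℕ → ℝ) (k₀ p : ℕ) (s : Finset ι) (I : ι → Finset ℕ)
    (T : ι → Finset (List ℕ)) (A A₀ : Finset ℕ) : Prop :=
  ∃ l : List ℕ, l.length = k₀ ∧ IsMonoSubseq f l ∧
    (∃ i ∈ s, ∀ x ∈ l, x ∈ I i ∧ x ∈ indices (T i)) ∧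
    (∀ x ∈ l, x ∈ A) ∧ (∃ x ∈ A₀, l[p - 1]? = some x)

/-- The sampling procedure, run on a set `D` in which the families represented by `t` are dense
enough, finds a tuple with high probability. -/
def FindsWithHighProb (f : ℕ → ℝ) (k n m : ℕ) (K ρ : ℝ) (t : WTree) : Prop :=
  -- The generality in the family, `W`, `r` and `D` is what the induction uses: the larger subtree
  -- is applied to many intervals in the same `D`, the smaller one to a single interval inside a
  -- ball, with fewer rounds and other points kept.
  ∀ (ι : Type) (s : Finset ι) (I : ι → Finset ℕ) (T : ι → Finset (List ℕ))
    (ivl : ι → List Bool → Finset (Finset ℕ)) (W : Finset ℕ) (r : ℕ) (D : Finset ℕ),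
    D ⊆ Finset.Icc 1 n → D.Nonempty → Nat.log 2 t.leaves ≤ r →
    (∀ i ∈ s, I i ⊆ D) → (∀ i ∈ s, I i ⊆ W) → (s : Set ι).PairwiseDisjoint I →
    (∀ i ∈ s, IsTupleFamily f t.leaves (I i) (T i)) →
    (∀ i ∈ s, DescriptorRec f k K t (ivl i) (T i) (I i)) →
    100 * k * ρ * D.card ≤ ∑ i ∈ s, ((T i).card : ℝ) →
    ENNReal.ofReal (1 - t.leaves / (100 * k)) ≤
      eventProb n m ρ W r D (Finds f t.leaves t.primaryIndex s I T)

lemma findsWithHighProb_leaf {f : ℕ → ℝ} {k : ℕ} (hk : 1 ≤ k) (K : ℝ) (hρ : 0 < ρ) (w : ℕ) :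
    FindsWithHighProb f k n m K ρ (.leaf w) := by
  intro ι s I T ivl W r D _ hD _ hID hIW hdisj hT _ hcard
  set E : Finset ℕ := s.biUnion fun i => indices (T i) with hE
  have hEsub : E ⊆ D ∩ W := by
    refine Finset.biUnion_subset.2 fun i hi => ?_
    exact (hT i hi).indices_subset.trans (Finset.subset_inter (hID i hi) (hIW i hi))
  have hEcard : ∑ i ∈ s, (T i).card ≤ E.card := by
    rw [hE, Finset.card_biUnion]
    · exact Finset.sum_le_sum fun i hi => (hT i hi).card_le_indices Nat.one_pos
    · intro i hi j hj hij
      exact (hdisj hi hj hij).mono (hT i hi).indices_subset (hT j hj).indices_subset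
  have hEcard' : (100 * k : ℝ) * ρ * D.card ≤ E.card := by
    refine hcard.trans ?_
    exact_mod_cast hEcard
  have hk' : (0 : ℝ) < 100 * k := by
    have : (1 : ℝ) ≤ k := by exact_mod_cast hk
    linarith
  have h := expect_firstRound_hit hEsub hρ hD hk' hEcard'
  simp only [WTree.leaves, WTree.primaryIndex, Nat.cast_one]
  refine h.trans ?_
  rw [eventProb]
  refine expect_mono _ fun A => ?_
  rw [← expect_const (extension n m ρ W r A) (Set.indicator _ _ _)]
  refine expect_mono _ fun R => indicator_mono ?_
  rintro ⟨a, haE, haA⟩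
  obtain ⟨i, hi, hai⟩ := Finset.mem_biUnion.1 haE
  refine ⟨[a], rfl, List.pairwise_singleton _ _, ⟨i, hi, ?_⟩, ?_, a, haA, by simp⟩
  · simpa using ⟨(hT i hi).indices_subset hai, hai⟩
  · simpa using ⟨Or.inl haA, (Finset.mem_inter.1 (hEsub haE)).1⟩

/-- The inductive step: `P x` and `Q x` are disjoint subsets of the interval `J x` that carry the
tuples of the subtrees `tp` and `tq`, of which `tp` is the larger one. -/
lemma eventProb_of_subtrees {f : ℕ → ℝ} {k : ℕ} {K α : ℝ} (hk : 1 ≤ k) (hα : 0 < α)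
    (hρα : 800 * k * ρ ≤ α) (hn : n ≤ 2 ^ m) {tp tq : WTree}
    (hp : FindsWithHighProb f k n m K ρ tp) (hq : FindsWithHighProb f k n m K ρ tq)
    (hle : tq.leaves ≤ tp.leaves) (hlek : tp.leaves + tq.leaves ≤ k) {κ : Type} {s : Finset κ}
    {J P Q : κ → Finset ℕ} {TP TQ : κ → Finset (List ℕ)}
    {ivlP ivlQ : κ → List Bool → Finset (Finset ℕ)} {W D : Finset ℕ} {r : ℕ}
    (hDn : D ⊆ Finset.Icc 1 n) (hD : D.Nonempty) (hr : Nat.log 2 (tp.leaves + tq.leaves) ≤ r)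
    (hJD : ∀ x ∈ s, J x ⊆ D) (hJW : ∀ x ∈ s, J x ⊆ W) (hJint : ∀ x ∈ s, IsInterval (J x))
    (hJ : (s : Set κ).PairwiseDisjoint J) (hPJ : ∀ x ∈ s, P x ⊆ J x) (hQJ : ∀ x ∈ s, Q x ⊆ J x)
    (hPQ : ∀ x ∈ s, Disjoint (P x) (Q x))
    (hTP : ∀ x ∈ s, IsTupleFamily f tp.leaves (P x) (TP x))
    (hTQ : ∀ x ∈ s, IsTupleFamily f tq.leaves (Q x) (TQ x))
    (hdP : ∀ x ∈ s, DescriptorRec f k K tp (ivlP x) (TP x) (P x))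
    (hdQ : ∀ x ∈ s, DescriptorRec f k K tq (ivlQ x) (TQ x) (Q x))
    (hcardP : 100 * k * ρ * D.card ≤ ∑ x ∈ s, ((TP x).card : ℝ))
    (hcardQ : ∀ x ∈ s, α / 2 * (J x).card ≤ (TQ x).card)
    {G : Finset ℕ → Finset ℕ → Prop} (hG : ∀ A A' B B', A ⊆ A' → B ⊆ B' → G A B → G A' B')
    (hcomb : ∀ x ∈ s, ∀ lp lq : List ℕ, lp.length = tp.leaves → lq.length = tq.leaves →
      IsMonoSubseq f lp → IsMonoSubseq f lq → (∀ i ∈ lp, i ∈ P x ∧ i ∈ indices (TP x)) →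
      (∀ i ∈ lq, i ∈ Q x ∧ i ∈ indices (TQ x)) → ∀ A A₀ : Finset ℕ, (∀ i ∈ lp, i ∈ A) →
      (∀ i ∈ lq, i ∈ A) → (∃ i ∈ A₀, lp[tp.primaryIndex - 1]? = some i) → G A A₀) :
    ENNReal.ofReal (1 - (tp.leaves + tq.leaves : ℕ) / (100 * k)) ≤ eventProb n m ρ W r D G := by
  have hp0 := tp.leaves_pos
  have hq0 := tq.leaves_pos
  obtain ⟨r, rfl⟩ : ∃ r', r = r' + 1 := by
    have : 0 < Nat.log 2 (tp.leaves + tq.leaves) := Nat.log_pos one_lt_two (by omega)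
    exact ⟨r - 1, by omega⟩
  -- The smaller subtree has at most half of the leaves, which pays for the round spent on the
  -- larger one.
  have hrq : Nat.log 2 tq.leaves ≤ r := by
    have h1 : Nat.log 2 (tq.leaves * 2) ≤ r + 1 :=
      (Nat.log_mono_right (by omega)).trans hr
    rw [Nat.log_mul_base one_lt_two hq0.ne'] at h1
    omega
  set U : Finset ℕ := s.biUnion P with hU
  have hUW : U ⊆ W := Finset.biUnion_subset.2 fun x hx => (hPJ x hx).trans (hJW x hx)
  have hPdisj : (s : Set κ).PairwiseDisjoint P := fun x hx y hy hxy =>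
    (hJ hx hy hxy).mono (hPJ x hx) (hPJ y hy)
  have hQV : ∀ x ∈ s, Q x ⊆ W \ U := by
    intro x hx i hi
    refine Finset.mem_sdiff.2 ⟨hJW x hx (hQJ x hx hi), fun hiU => ?_⟩
    obtain ⟨y, hy, hiy⟩ := Finset.mem_biUnion.1 hiU
    by_cases hxy : x = y
    · subst hxy
      exact Finset.disjoint_left.1 (hPQ x hx) hiy hi
    · exact Finset.disjoint_left.1 (hJ hx hy hxy) (hQJ x hx hi) (hPJ y hy hiy)
  have hfirst := hp κ s P TP ivlP U (r + 1) D hDn hD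
    ((Nat.log_mono_right (by omega)).trans hr) (fun x hx => (hPJ x hx).trans (hJD x hx))
    (fun x hx => Finset.subset_biUnion_of_mem P hx) hPdisj hTP hdP hcardP
  have hk' : (1 : ℝ) ≤ k := by exact_mod_cast hk
  -- (1 - x)(1 - y) ≥ 1 - (x + y), so failure probabilities add up over the leaves.
  have hprod : ENNReal.ofReal (1 - (tp.leaves + tq.leaves : ℕ) / (100 * k)) ≤
      ENNReal.ofReal (1 - tp.leaves / (100 * k)) * ENNReal.ofReal (1 - tq.leaves / (100 * k)) := by
    have hpk : (tp.leaves : ℝ) / (100 * k) ≤ 1 := by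
      rw [div_le_one (by linarith)]
      have : (tp.leaves : ℝ) ≤ k := by exact_mod_cast (by omega : tp.leaves ≤ k)
      linarith
    rw [← ENNReal.ofReal_mul (by linarith)]
    refine ENNReal.ofReal_le_ofReal ?_
    have h1 : 0 ≤ (tp.leaves : ℝ) / (100 * k) := by positivity
    have h2 : 0 ≤ (tq.leaves : ℝ) / (100 * k) := by positivity
    push_cast
    rw [add_div]
    nlinarith [mul_nonneg h1 h2]
  refine hprod.trans (eventProb_superposition hUW hG hfirst ?_)
  rintro A A₀ ⟨lp, hlp, hmp, ⟨x, hx, hlpx⟩, hlpA, a, haA₀, ha⟩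
  have halp : a ∈ lp := List.mem_of_getElem? ha
  have haJ : a ∈ J x := hPJ x hx (hlpx a halp).1
  have hJpos : 0 < (J x).card := Finset.card_pos.2 ⟨a, haJ⟩
  -- `J x` contains `a` from the `P`-side and some point of the disjoint `Q`-side.
  have h2 : 2 ≤ (J x).card := by
    have h3 : (0 : ℝ) < (TQ x).card := by
      refine lt_of_lt_of_le ?_ (hcardQ x hx)
      have : (0 : ℝ) < (J x).card := by exact_mod_cast hJpos
      positivity
    obtain ⟨l, hl⟩ := Finset.card_pos.1 (by exact_mod_cast h3 : 0 < (TQ x).card)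
    obtain ⟨b, hb⟩ := List.exists_mem_of_length_pos (l := l)
      (by rw [((hTQ x hx).1 l hl).1]; exact hq0)
    have hbQ := ((hTQ x hx).1 l hl).2.1 b hb
    refine Finset.one_lt_card.2 ⟨a, haJ, b, hQJ x hx hbQ, ?_⟩
    rintro rfl
    exact Finset.disjoint_left.1 (hPQ x hx) (hlpx a halp).1 hbQ
  obtain ⟨j, hj, hJb, hbcard⟩ :=
    exists_ball_of_isInterval (hJint x hx) ((hJD x hx).trans hDn) hn haJ h2
  refine ⟨a, haA₀, j, hj, ?_⟩
  have hdense : 100 * k * ρ * (ball n a j).card ≤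
      ∑ _i ∈ ({()} : Finset Unit), ((TQ x).card : ℝ) := by
    rw [Finset.sum_singleton]
    refine le_trans ?_ (hcardQ x hx)
    have h4 : ((ball n a j).card : ℝ) ≤ 4 * (J x).card := by exact_mod_cast hbcard
    -- The constant 800 is 100 · 2 · 4: failure 1/(100k), rounding of the label, and size of the
    -- ball relative to `J x`.
    have h5 : 100 * k * ρ ≤ α / 8 := by linarith
    calc 100 * k * ρ * (ball n a j).card ≤ α / 8 * (ball n a j).card := by gcongr
      _ ≤ α / 8 * (4 * (J x).card) := by gcongr
      _ = _ := by ring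
  have hsecond := hq Unit {()} (fun _ => Q x) (fun _ => TQ x) (fun _ => ivlQ x) (W \ U) r
    (ball n a j) (ball_subset n a j) ⟨a, hJb haJ⟩ hrq
    (fun _ _ => (hQJ x hx).trans hJb) (fun _ _ => hQV x hx) (by simp) (fun _ _ => hTQ x hx)
    (fun _ _ => hdQ x hx) hdense
  refine hsecond.trans ?_
  rw [expect_restrictedSample, eventProb]
  refine expect_mono _ fun A₁ => expect_mono _ fun R => indicator_mono ?_
  rintro ⟨lq, hlq, hmq, ⟨_, _, hlqx⟩, hlqA, -⟩
  refine hcomb x hx lp lq hlp hlq hmp hmq hlpx hlqx _ _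
    (fun i hi => Finset.mem_union_left _ (hlpA i hi)) (fun i hi => ?_) ⟨a, haA₀, ha⟩
  exact Finset.mem_union_right _
    (Finset.mem_inter.2 ⟨hlqA i hi, hJD x hx (hQJ x hx (hlqx i hi).1)⟩)

lemma finds_mono {ι : Type} {f : ℕ → ℝ} {k₀ p : ℕ} {s : Finset ι} {I : ι → Finset ℕ}
    {T : ι → Finset (List ℕ)} (A A' B B' : Finset ℕ) (hA : A ⊆ A') (hB : B ⊆ B') :
    Finds f k₀ p s I T A B → Finds f k₀ p s I T A' B' := by
  rintro ⟨l, hl, hm, hi, hlA, x, hx, hlx⟩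
  exact ⟨l, hl, hm, hi, fun x hx => hA (hlA x hx), x, hB hx, hlx⟩

lemma findsWithHighProb_node {f : ℕ → ℝ} {k : ℕ} {K α : ℝ} (hk : 1 ≤ k) (hα : 0 < α)
    (hρα : 800 * k * ρ ≤ α) (hn : n ≤ 2 ^ m) {w : ℕ} {tl tr : WTree}
    (hlek : tl.leaves + tr.leaves ≤ k) (hw : 1 ≤ w ∧ w ≤ ⌈Real.logb 2 (1 / α)⌉₊)
    (hl : FindsWithHighProb f k n m K ρ tl) (hr : FindsWithHighProb f k n m K ρ tr) :
    FindsWithHighProb f k n m K ρ (.node w tl tr) := by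
  intro ι s I T ivl W r D hDn hD hlog hID hIW hdisj hT hdesc hcard
  simp only [WTree.leaves] at hlog hT ⊢
  have hl0 := tl.leaves_pos
  have hr0 := tr.leaves_pos
  have hβ := half_le_two_zpow_neg hα hw.1 hw.2
  set c := tl.leaves with hc
  have hex : ∀ i ∈ s, ∀ J ∈ ivl i [], ∃ LR : Finset ℕ × Finset ℕ, ∃ M : Finset ℕ,
      IsSplitPartition c (1 / (6 * k)) J (restrict (T i) J) LR.1 M LR.2 ∧
      DescriptorRec f k K tl (fun v => (ivl i (false :: v)).filter (· ⊆ LR.1))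
        (prefixes c (restrict (T i) J)) LR.1 ∧
      DescriptorRec f k K tr (fun v => (ivl i (true :: v)).filter (· ⊆ LR.2))
        (suffixes c (restrict (T i) J)) LR.2 := by
    intro i hi J hJ
    obtain ⟨L, M, R, h⟩ := (hdesc i hi).2.2.2 J hJ
    exact ⟨(L, R), M, h⟩
  choose! LR M hpart hdl hdr using hex
  -- The splittable pieces of all `I i` are pooled, because only the total number of tuples is large
  -- compared with `D`.
  set s' : Finset (Σ _ : ι, Finset ℕ) := s.sigma fun i => ivl i [] with hs'
  have hmem : ∀ x ∈ s', x.1 ∈ s ∧ x.2 ∈ ivl x.1 [] := fun x hx => Finset.mem_sigma.1 hx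
  have hJI : ∀ x ∈ s', x.2 ⊆ I x.1 := fun x hx =>
    (hdesc x.1 (hmem x hx).1).1 x.2 (hmem x hx).2
  have hsplit : ∀ x ∈ s', IsInterval x.2 ∧
      IsSplittable f c (1 / (6 * k)) ((2 : ℝ) ^ (-(w : ℤ))) x.2 (restrict (T x.1) x.2) :=
    fun x hx => (hdesc x.1 (hmem x hx).1).2.1.2.1 x.2 (hmem x hx).2
  have hpart' : ∀ x ∈ s', IsSplitPartition c (1 / (6 * k)) x.2 (restrict (T x.1) x.2)
      (LR x.1 x.2).1 (M x.1 x.2) (LR x.1 x.2).2 :=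
    fun x hx => hpart x.1 (hmem x hx).1 x.2 (hmem x hx).2
  have hfam : ∀ x ∈ s', IsTupleFamily f (c + tr.leaves) x.2 (restrict (T x.1) x.2) :=
    fun x hx => (hT x.1 (hmem x hx).1).restrict x.2
  have hlenL : ∀ l : List ℕ, l.length = c + tr.leaves → (l.take c).length = c := by
    intro l h; rw [List.length_take, h]; omega
  have hlenR : ∀ l : List ℕ, l.length = c + tr.leaves → (l.drop c).length = tr.leaves := by
    intro l h; rw [List.length_drop, h]; omega
  have hfamL : ∀ x ∈ s', IsTupleFamily f c (LR x.1 x.2).1 (prefixes c (restrict (T x.1) x.2)) :=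
    fun x hx => (hfam x hx).image (List.take_sublist c) hlenL (hpart' x hx).2.2.2.2.2.2.1
  have hfamR : ∀ x ∈ s', IsTupleFamily f tr.leaves (LR x.1 x.2).2
      (suffixes c (restrict (T x.1) x.2)) :=
    fun x hx => (hfam x hx).image (List.drop_sublist c) hlenR (hpart' x hx).2.2.2.2.2.2.2
  have hcardL : ∀ x ∈ s', (prefixes c (restrict (T x.1) x.2)).card =
      (restrict (T x.1) x.2).card :=
    fun x hx => (hfam x hx).card_image (List.take_sublist c) hlenL hl0
  have hcardR : ∀ x ∈ s', (suffixes c (restrict (T x.1) x.2)).card =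
      (restrict (T x.1) x.2).card :=
    fun x hx => (hfam x hx).card_image (List.drop_sublist c) hlenR hr0
  have hsum : ∑ i ∈ s, ((T i).card : ℝ) = ∑ x ∈ s', ((restrict (T x.1) x.2).card : ℝ) := by
    rw [hs', Finset.sum_sigma]
    refine Finset.sum_congr rfl fun i hi => ?_
    have h := (hdesc i hi).2.1
    conv_lhs => rw [← h.2.2.2, Finset.card_biUnion h.2.2.1]
    push_cast
    rfl
  have hdense : ∀ x ∈ s', α / 2 * (x.2.card : ℝ) ≤ (restrict (T x.1) x.2).card := by
    intro x hx
    have h := (hsplit x hx).2.1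
    rcases Nat.eq_zero_or_pos x.2.card with h0 | h0
    · rw [h0]; simp
    · have h0' : (0 : ℝ) < x.2.card := by exact_mod_cast h0
      rw [le_div_iff₀ h0'] at h
      refine le_trans ?_ h
      gcongr
  have hJdisj : (s' : Set (Σ _ : ι, Finset ℕ)).PairwiseDisjoint fun x => x.2 := by
    rintro ⟨i, J⟩ hx ⟨i', J'⟩ hy hxy
    have hx' := hmem _ hx
    have hy' := hmem _ hy
    by_cases hii : i = i'
    · subst hii
      have hJJ : J ≠ J' := fun h => hxy (h ▸ rfl)
      exact (hdesc i hx'.1).2.1.1 hx'.2 hy'.2 hJJ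
    · exact (hdisj hx'.1 hy'.1 hii).mono (hJI _ hx) (hJI _ hy)
  have hLJ : ∀ x ∈ s', (LR x.1 x.2).1 ⊆ x.2 := fun x hx i hi => by
    rw [← (hpart' x hx).2.1]; simp [hi]
  have hRJ : ∀ x ∈ s', (LR x.1 x.2).2 ⊆ x.2 := fun x hx i hi => by
    rw [← (hpart' x hx).2.1]; simp [hi]
  have hlt : ∀ x ∈ s', ∀ a ∈ (LR x.1 x.2).1, ∀ b ∈ (LR x.1 x.2).2, a < b :=
    fun x hx => (hpart' x hx).2.2.2.2.1
  have hLR : ∀ x ∈ s', Disjoint (LR x.1 x.2).1 (LR x.1 x.2).2 := fun x hx =>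
    Finset.disjoint_left.2 fun a ha ha' => lt_irrefl a (hlt x hx a ha a ha')
  have happ : ∀ x ∈ s', ∀ l₁ l₂ : List ℕ, l₁.length = c → l₂.length = tr.leaves →
      IsMonoSubseq f l₁ → IsMonoSubseq f l₂ →
      (∀ i ∈ l₁, i ∈ (LR x.1 x.2).1 ∧ i ∈ indices (prefixes c (restrict (T x.1) x.2))) →
      (∀ i ∈ l₂, i ∈ (LR x.1 x.2).2 ∧ i ∈ indices (suffixes c (restrict (T x.1) x.2))) →
      ∀ A A₀ : Finset ℕ, (∀ i ∈ l₁, i ∈ A) → (∀ i ∈ l₂, i ∈ A) →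
      (∃ i ∈ A₀, (l₁ ++ l₂)[(WTree.node w tl tr).primaryIndex - 1]? = some i) →
      Finds f (c + tr.leaves) (WTree.node w tl tr).primaryIndex s I T A A₀ := by
    intro x hx l₁ l₂ h₁ h₂ hm₁ hm₂ hl₁ hl₂ A A₀ hA₁ hA₂ hA₀
    refine ⟨l₁ ++ l₂, by rw [List.length_append, h₁, h₂], ?_, ⟨x.1, (hmem x hx).1, ?_⟩, ?_, hA₀⟩
    · refine List.pairwise_append.2 ⟨hm₁, hm₂, fun a ha b hb => ⟨?_, ?_⟩⟩
      · exact hlt x hx a (hl₁ a ha).1 b (hl₂ b hb).1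
      · exact lt_of_mem_prefixes_of_mem_suffixes (hfam x hx) (hsplit x hx).2.2.1
          (hl₁ a ha).2 (hl₂ b hb).2
    · have hsub : ∀ i ∈ indices (restrict (T x.1) x.2), i ∈ indices (T x.1) := by
        intro i hi
        obtain ⟨l, hl, hil⟩ := mem_indices.1 hi
        exact mem_indices.2 ⟨l, (Finset.mem_filter.1 hl).1, hil⟩
      intro i hi
      rcases List.mem_append.1 hi with hi | hi
      · refine ⟨hJI x hx (hLJ x hx (hl₁ i hi).1), hsub i ?_⟩
        obtain ⟨l, hl, hil⟩ := mem_indices.1 (hl₁ i hi).2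
        obtain ⟨l, hl', rfl⟩ := Finset.mem_image.1 hl
        exact mem_indices.2 ⟨l, hl', List.mem_of_mem_take hil⟩
      · refine ⟨hJI x hx (hRJ x hx (hl₂ i hi).1), hsub i ?_⟩
        obtain ⟨l, hl, hil⟩ := mem_indices.1 (hl₂ i hi).2
        obtain ⟨l, hl', rfl⟩ := Finset.mem_image.1 hl
        exact mem_indices.2 ⟨l, hl', List.mem_of_mem_drop hil⟩
    · intro i hi
      rcases List.mem_append.1 hi with hi | hi
      · exact hA₁ i hi
      · exact hA₂ i hi
  have hJD : ∀ x ∈ s', x.2 ⊆ D := fun x hx => (hJI x hx).trans (hID x.1 (hmem x hx).1)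
  have hJW : ∀ x ∈ s', x.2 ⊆ W := fun x hx => (hJI x hx).trans (hIW x.1 (hmem x hx).1)
  rcases le_or_gt tr.leaves tl.leaves with hle | hlt'
  · refine eventProb_of_subtrees hk hα hρα hn hl hr hle hlek hDn hD hlog hJD hJW
      (fun x hx => (hsplit x hx).1) hJdisj hLJ hRJ hLR hfamL hfamR
      (fun x hx => hdl x.1 (hmem x hx).1 x.2 (hmem x hx).2)
      (fun x hx => hdr x.1 (hmem x hx).1 x.2 (hmem x hx).2) ?_ ?_ finds_mono ?_
    · rw [Finset.sum_congr rfl fun x hx => congrArg Nat.cast (hcardL x hx), ← hsum]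
      exact hcard
    · intro x hx
      rw [hcardR x hx]
      exact hdense x hx
    · intro x hx lp lq hlp hlq hmp hmq hlpx hlqx A A₀ hlpA hlqA ⟨a, ha, hpa⟩
      refine happ x hx lp lq hlp hlq hmp hmq hlpx hlqx A A₀ hlpA hlqA ⟨a, ha, ?_⟩
      obtain ⟨hlen, -⟩ := List.getElem?_eq_some_iff.1 hpa
      rw [WTree.primaryIndex, if_pos hle, List.getElem?_append_left hlen, hpa]
  -- Now the suffixes are searched first. They still come second in the concatenation, so the
  -- primary index is shifted by the length of the prefix.
  · rw [add_comm] at hlog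
    conv_lhs => rw [add_comm]
    refine eventProb_of_subtrees hk hα hρα hn hr hl hlt'.le (by omega) hDn hD hlog hJD hJW
      (fun x hx => (hsplit x hx).1) hJdisj hRJ hLJ (fun x hx => (hLR x hx).symm) hfamR hfamL
      (fun x hx => hdr x.1 (hmem x hx).1 x.2 (hmem x hx).2)
      (fun x hx => hdl x.1 (hmem x hx).1 x.2 (hmem x hx).2) ?_ ?_ finds_mono ?_
    · rw [Finset.sum_congr rfl fun x hx => congrArg Nat.cast (hcardR x hx), ← hsum]
      exact hcard
    · intro x hx
      rw [hcardL x hx]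
      exact hdense x hx
    · intro x hx lp lq hlp hlq hmp hmq hlpx hlqx A A₀ hlpA hlqA ⟨a, ha, hpa⟩
      refine happ x hx lq lp hlq hlp hmq hmp hlqx hlpx A A₀ hlqA hlpA ⟨a, ha, ?_⟩
      have h0 := tr.primaryIndex_pos
      rw [WTree.primaryIndex, if_neg (by omega), List.getElem?_append_right (by omega), hlq,
        ← hpa]
      congr 1
      omega

lemma findsWithHighProb {f : ℕ → ℝ} {k : ℕ} {K α : ℝ} (hk : 1 ≤ k) (hα : 0 < α) (hρ : 0 < ρ)
    (hρα : 800 * k * ρ ≤ α) (hn : n ≤ 2 ^ m) (t : WTree) (htk : t.leaves ≤ k)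
    (ht : t.LabelsIn ⌈Real.logb 2 (1 / α)⌉₊) : FindsWithHighProb f k n m K ρ t := by
  induction t with
  | leaf w => exact findsWithHighProb_leaf hk K hρ w
  | node w l r ihl ihr =>
    simp only [WTree.leaves] at htk
    exact findsWithHighProb_node hk hα hρα hn htk ht.1 (ihl (by omega) ht.2.1)
      (ihr (by omega) ht.2.2)

/-! ### The non-adaptive algorithm -/

lemma subset_of_mem_support_restrictedSample {U D A : Finset ℕ} {r : ℕ}
    (h : A ∈ (restrictedSample n m ρ U r D).support) : A ⊆ D := by
  rw [restrictedSample, PMF.mem_support_bind_iff] at h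
  obtain ⟨A₀, -, h⟩ := h
  obtain ⟨R, -, rfl⟩ := (PMF.mem_support_map_iff _ _ _).1 h
  exact Finset.inter_subset_right

lemma exists_output_sampleSplittable {k q : ℕ} {f : ℕ → ℝ} {Q : Finset ℕ}
    (hQ : Q ⊆ Finset.Icc 1 n) {l : List ℕ} (hl : l.length = k) (hm : IsMonoSubseq f l)
    (hlQ : ∀ x ∈ l, x ∈ Q) :
    ∃ l' : List ℕ, (sampleSplittable k n ρ q).output Q (fun x => f x) = some l' ∧
      l'.length = k ∧ (∀ x ∈ l', x ∈ Finset.Icc 1 n) ∧ IsMonoSubseq f l' := by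
  have hex : ∃ l : List Q, l.length = k ∧
      l.Pairwise (fun a b : Q => a < b ∧ f a < f b) := by
    lift l to List Q using hlQ
    refine ⟨l, by simpa using hl, ?_⟩
    exact List.pairwise_map.1 hm
  refine ⟨hex.choose.map Subtype.val, ?_, ?_, ?_, ?_⟩
  · simp only [sampleSplittable]
    exact dif_pos hex
  · rw [List.length_map, hex.choose_spec.1]
  · intro x hx
    obtain ⟨y, -, rfl⟩ := List.mem_map.1 hx
    exact hQ y.2
  · exact List.pairwise_map.2 hex.choose_spec.2

lemma sampleSplittable_queries {k q : ℕ} {Q : Finset ℕ}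
    (hQ : Q ∈ (sampleSplittable k n ρ q).queries.support) :
    Q ⊆ Finset.Icc 1 n ∧ Q.card ≤ q := by
  obtain ⟨A, hA, rfl⟩ := (PMF.mem_support_map_iff _ _ _).1 hQ
  rw [sampleHelper_eq_restrictedSample _ subset_rfl] at hA
  split_ifs with h
  · exact ⟨subset_of_mem_support_restrictedSample hA, h⟩
  · simp

/-- Failure means that no tuple was sampled or that more than `q` indices were; Markov's inequality
bounds the latter by `b`. -/
lemma successProb_sampleSplittable {k q : ℕ} (hρ : 0 < ρ) {f : ℕ → ℝ} {a b : ℝ} (ha : 0 ≤ a)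
    (hb : 0 ≤ b)
    (hfind : ENNReal.ofReal (a + b) ≤
      expect (sampleHelper n (Nat.clog 2 n) ρ (Nat.log 2 k) (Finset.Icc 1 n))
        ({A | ∃ l : List ℕ, l.length = k ∧ IsMonoSubseq f l ∧ ∀ x ∈ l, x ∈ A}.indicator 1))
    (hsize : sizeBound (Nat.clog 2 n) ρ (Nat.log 2 k) ≤ b * (q + 1)) :
    ENNReal.ofReal a ≤ (sampleSplittable k n ρ q).successProb k n f := by
  set p := sampleHelper n (Nat.clog 2 n) ρ (Nat.log 2 k) (Finset.Icc 1 n) with hp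
  have hp' : p = restrictedSample n (Nat.clog 2 n) ρ (Finset.Icc 1 n) (Nat.log 2 k)
    (Finset.Icc 1 n) := sampleHelper_eq_restrictedSample _ subset_rfl
  have hmarkov : expect p ({A | ((q + 1 : ℕ) : ℝ≥0∞) ≤ A.card}.indicator 1) ≤
      ENNReal.ofReal b := by
    refine (expect_markov p (fun A => (A.card : ℝ≥0∞)) (by simp) (by simp)).trans ?_
    refine ENNReal.div_le_of_le_mul ?_
    rw [← ENNReal.ofReal_natCast, ← ENNReal.ofReal_mul hb, hp']
    refine (expect_card_restrictedSample_le hρ _ _ _).trans (ENNReal.ofReal_le_ofReal ?_)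
    exact_mod_cast hsize
  have hadd : ENNReal.ofReal (a + b) ≤
      (sampleSplittable k n ρ q).successProb k n f + ENNReal.ofReal b := by
    refine hfind.trans (le_trans ?_ (add_le_add le_rfl hmarkov))
    rw [NonadaptiveAlgorithm.successProb, toOuterMeasure_eq_expect]
    change _ ≤ expect (p.map _) _ + _
    rw [expect_map, ← expect_add]
    refine expect_mono_of_support fun A hA => ?_
    have hAn : A ⊆ Finset.Icc 1 n := subset_of_mem_support_restrictedSample (hp' ▸ hA)
    by_cases hq : A.card ≤ q
    · rw [if_pos hq]
      refine le_trans (indicator_mono ?_) le_self_add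
      rintro ⟨l, hl, hm, hlA⟩
      exact exists_output_sampleSplittable hAn hl hm hlA
    · refine le_trans (indicator_mono ?_) le_add_self
      intro _
      have : q + 1 ≤ A.card := by omega
      exact_mod_cast this
  rw [ENNReal.ofReal_add ha hb] at hadd
  exact (ENNReal.add_le_add_iff_right ENNReal.ofReal_ne_top).1 hadd

/-! ### Estimates for the number of queries -/

/-- Absorbing the summand 1 of the recursion into the other one costs the factor 2 per level. -/
lemma sizeBound_le (hm : 1 ≤ m) (h0 : 0 < ρ) (h1 : ρ ≤ 1) (r : ℕ) :
    sizeBound m ρ r ≤ (2 * m / ρ) ^ r * (1 / ρ) := by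
  have hm' : (1 : ℝ) ≤ m := by exact_mod_cast hm
  induction r with
  | zero => simp [sizeBound]
  | succ r ih =>
    have hρ1 : 1 ≤ 1 / ρ := by rwa [le_div_iff₀ h0, one_mul]
    have hbase : 1 ≤ 2 * m / ρ := by rw [le_div_iff₀ h0]; linarith
    have hX : 1 ≤ (2 * m / ρ) ^ r * (1 / ρ) := one_le_mul_of_one_le_of_one_le
      (one_le_pow₀ hbase) hρ1
    rw [sizeBound]
    calc 1 / ρ * (1 + m * sizeBound m ρ r)
        ≤ 1 / ρ * (1 + m * ((2 * m / ρ) ^ r * (1 / ρ))) := by gcongr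
      _ ≤ 1 / ρ * (m * ((2 * m / ρ) ^ r * (1 / ρ)) + m * ((2 * m / ρ) ^ r * (1 / ρ))) := by
          gcongr
          exact one_le_mul_of_one_le_of_one_le hm' hX
      _ = (2 * m / ρ) ^ (r + 1) * (1 / ρ) := by rw [pow_succ]; ring

lemma clog_le_two_mul_logb (hn : 2 ≤ n) : (Nat.clog 2 n : ℝ) ≤ 2 * Real.logb 2 n := by
  have hn0 : (0 : ℝ) < n := by exact_mod_cast (by omega : 0 < n)
  have h1 : 2 ^ (Nat.clog 2 n - 1) < n := Nat.pow_pred_clog_lt_self one_lt_two hn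
  have hpos : 1 ≤ Nat.clog 2 n := Nat.clog_pos one_lt_two hn
  have h2 : ((Nat.clog 2 n - 1 : ℕ) : ℝ) ≤ Real.logb 2 n := by
    rw [Real.le_logb_iff_rpow_le one_lt_two hn0, Real.rpow_natCast]
    exact_mod_cast h1.le
  have h3 : 1 ≤ Real.logb 2 n := by
    rw [Real.le_logb_iff_rpow_le one_lt_two hn0, Real.rpow_one]
    exact_mod_cast hn
  rw [Nat.cast_sub hpos] at h2
  push_cast at h2
  linarith

lemma one_le_logb_two_div {ε : ℝ} (h0 : 0 < ε) (h1 : ε ≤ 1) : 1 ≤ Real.logb 2 (2 / ε) := by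
  rw [Real.le_logb_iff_rpow_le one_lt_two (by positivity), Real.rpow_one, le_div_iff₀ h0]
  linarith

lemma one_le_polylog {A : ℕ} (hA : 1 ≤ A) {ε : ℝ} (h0 : 0 < ε) (h1 : ε ≤ 1) :
    1 ≤ polylog A ε :=
  one_le_mul_of_one_le_of_one_le (by exact_mod_cast hA)
    (one_le_pow₀ (one_le_logb_two_div h0 h1))

/-- In `polylog` one number is both coefficient and exponent, so the sum of the two required values
is used. -/
lemma mul_polylog_pow_le {A c N s : ℕ} {ε : ℝ} (h0 : 0 < ε) (h1 : ε ≤ 1) :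
    (N : ℝ) * (c * polylog A ε) ^ s ≤ polylog (N * (c * A) ^ s + A * s) ε := by
  have hx := one_le_logb_two_div h0 h1
  rw [polylog, polylog]
  set x := Real.logb 2 (2 / ε)
  calc (N : ℝ) * (c * (A * x ^ A)) ^ s = (N * (c * A) ^ s : ℕ) * x ^ (A * s) := by
        push_cast
        rw [pow_mul]
        ring
    _ ≤ (N * (c * A) ^ s + A * s : ℕ) * x ^ (N * (c * A) ^ s + A * s) := by
        gcongr <;> omega

/-- The factor 20 matches the Markov loss 1/20. For n = 1 and R > 0 the right side would vanish with
log n, which `hn` excludes. -/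
lemma sizeBound_le_queryBound {A k R : ℕ} (hk : 1 ≤ k) (hA : 1 ≤ A) {ε : ℝ} (h0 : 0 < ε)
    (h1 : ε ≤ 1) (hn : 2 ≤ n ∨ R = 0) :
    20 * sizeBound (Nat.clog 2 n) (ε / (800 * k * polylog A ε)) R ≤
      1 / ε * (Real.logb 2 n / ε) ^ R *
        polylog (20 * 4 ^ R * (800 * k * A) ^ (R + 1) + A * (R + 1)) ε := by
  have hP := one_le_polylog hA h0 h1
  have hk' : (1 : ℝ) ≤ k := by exact_mod_cast hk
  set P := polylog A ε with hPdef
  have hPk : 1 ≤ k * P := one_le_mul_of_one_le_of_one_le hk' hP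
  set σ := ε / (800 * k * P) with hσ
  have hσ0 : 0 < σ := by positivity
  have hσ1 : σ ≤ 1 := by
    rw [hσ, div_le_one (by positivity)]
    linarith
  have hlog : 0 ≤ Real.logb 2 n := by
    rcases Nat.eq_zero_or_pos n with rfl | hn0
    · simp
    · exact Real.logb_nonneg one_lt_two (by exact_mod_cast hn0)
  have hb : sizeBound (Nat.clog 2 n) σ R ≤ (4 * Real.logb 2 n / σ) ^ R * (1 / σ) := by
    rcases hn with hn | rfl
    · refine (sizeBound_le (Nat.clog_pos one_lt_two hn) hσ0 hσ1 R).trans ?_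
      have := clog_le_two_mul_logb hn
      gcongr ?_ ^ R * (1 / σ)
      rw [div_le_div_iff_of_pos_right hσ0]
      linarith
    · simp [sizeBound]
  have hB := mul_polylog_pow_le (A := A) (c := 800 * k) (N := 20 * 4 ^ R) (s := R + 1) h0 h1
  rw [← hPdef] at hB
  push_cast at hB
  calc 20 * sizeBound (Nat.clog 2 n) σ R ≤ 20 * ((4 * Real.logb 2 n / σ) ^ R * (1 / σ)) := by
        gcongr
    _ = 1 / ε * (Real.logb 2 n / ε) ^ R * (20 * 4 ^ R * (800 * k * P) ^ (R + 1)) := by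
        have h2 : 1 / σ = (800 * k * P) / ε := by rw [hσ, one_div_div]
        rw [div_eq_mul_one_div (4 * Real.logb 2 n) σ, h2, pow_succ]
        simp only [mul_pow, div_pow]
        ring
    _ ≤ _ := by gcongr

lemma le_of_isTupleFamily_nonempty {f : ℕ → ℝ} {k : ℕ} {T : Finset (List ℕ)}
    (hT : IsTupleFamily f k (Finset.Icc 1 n) T) (h : T.Nonempty) : k ≤ n := by
  obtain ⟨l, hl⟩ := h
  obtain ⟨hlen, hmem, hmono⟩ := hT.1 l hl
  have hnd : l.Nodup := hmono.imp fun h => h.1.ne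
  rw [← hlen, ← List.toFinset_card_of_nodup hnd]
  simpa using Finset.card_le_card (fun x hx => hmem x (List.mem_toFinset.1 hx) :
    l.toFinset ⊆ Finset.Icc 1 n)

end

end MonotoneSampling

theorem lemma3p7 (k : ℕ) (hk : 1 ≤ k) :
    -- the tree-descriptor lemma for `Sample-Helper*`
    (∃ C : ℝ, 0 < C ∧
      ∀ (d k₀ n m r : ℕ) (α ρ : ℝ) (f : ℕ → ℝ) (𝓘 : Finset (Finset ℕ))
        (T : Finset ℕ → Finset (List ℕ)) (t : WTree),
        1 ≤ k₀ → k₀ ≤ k → 1 ≤ n → n ≤ 2 ^ m → Nat.log 2 k₀ ≤ r →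
        0 < α → α < 1 → 0 < ρ → ρ < 1 → C * ρ ≤ α →
        (∀ I ∈ 𝓘, IsInterval I ∧ I ⊆ Finset.Icc 1 n) →
        (𝓘 : Set (Finset ℕ)).PairwiseDisjoint id →
        (∀ I ∈ 𝓘, IsTupleFamily f k₀ I (T I)) →
        α * n / 4 ≤ ∑ I ∈ 𝓘, ((T I).card : ℝ) →
        IsWeightedTree k₀ α t →
        (∀ I ∈ 𝓘, ∃ ivl : List Bool → Finset (Finset ℕ),
          IsTreeDescriptor d f k k₀ α t ivl (T I) I) →
        ENNReal.ofReal (1 - k₀ / (100 * k)) ≤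
          (sampleHelperStar n m ρ 𝓘 r (Finset.Icc 1 n)).toOuterMeasure
            {x | ∃ l : List ℕ, l.length = k₀ ∧ IsMonoSubseq f l ∧
              (∃ I ∈ 𝓘, ∀ i ∈ l, i ∈ I ∧ i ∈ indices (T I)) ∧
              (∀ i ∈ l, i ∈ x.1) ∧
              (∃ i ∈ x.2, l[t.primaryIndex - 1]? = some i)}) ∧
    -- the resulting non-adaptive sampler
    (∀ A : ℕ, 1 ≤ A → ∃ (B : ℕ) (ρ : ℝ → ℝ) (q : ℕ → ℝ → ℕ),
      ∀ (n : ℕ) (ε : ℝ), 1 ≤ n → 0 < ε → ε ≤ 1 →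
        (0 < ρ ε ∧ ρ ε < 1) ∧
        (∀ Q ∈ (sampleSplittable k n (ρ ε) (q n ε)).queries.support,
          Q ⊆ Finset.Icc 1 n ∧
          (Q.card : ℝ) ≤ 1 / ε * (Real.logb 2 n / ε) ^ Nat.log 2 k * polylog B ε) ∧
        (∀ (d : ℕ) (f : ℕ → ℝ) (T : Finset (List ℕ)) (α : ℝ) (t : WTree)
          (ivl : List Bool → Finset (Finset ℕ)),
          IsTupleFamily f k (Finset.Icc 1 n) T →
          ε * n / polylog A ε ≤ T.card →
          0 < α → α < 1 → ε / polylog A ε ≤ α →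
          IsTreeDescriptor d f k k α t ivl T (Finset.Icc 1 n) →
          ENNReal.ofReal (9 / 10) ≤
            (sampleSplittable k n (ρ ε) (q n ε)).successProb k n f)) := by
  have hk' : (1 : ℝ) ≤ k := by exact_mod_cast hk
  refine ⟨⟨800 * k, by positivity, ?_⟩, ?_⟩
  · intro d k₀ n m r α ρ f 𝓘 T t hk₀ hk₀k hn hnm hr hα _ hρ _ hρα h𝓘 hdisj hT hcard ht hdesc
    obtain ⟨rfl, hlab⟩ := ht
    choose! ivl hivl using hdesc
    have hfind := findsWithHighProb (f := f)
      (K := (d * (k + Real.logb 2 (1 / α)) ^ d) ^ k) hk hα hρ hρα hnm t hk₀k hlab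
      (Finset ℕ) 𝓘 id T ivl (𝓘.biUnion id) r (Finset.Icc 1 n) subset_rfl
      (Finset.nonempty_Icc.2 hn) hr (fun I hI => (h𝓘 I hI).2)
      (fun I hI => Finset.subset_biUnion_of_mem id hI) hdisj hT
      (fun I hI => (hivl I hI).2.2.2.2) (by
        rw [Nat.card_Icc, Nat.add_sub_cancel]
        refine le_trans ?_ hcard
        have hn' : (0 : ℝ) ≤ n := Nat.cast_nonneg n
        nlinarith [mul_le_mul_of_nonneg_right hρα hn', mul_nonneg hα.le hn'])
    rw [toOuterMeasure_eq_expect, expect_sampleHelperStar]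
    exact hfind
  · intro A hA
    set R := Nat.log 2 k with hR
    refine ⟨20 * 4 ^ R * (800 * k * A) ^ (R + 1) + A * (R + 1),
      fun ε => ε / (800 * k * polylog A ε),
      fun n ε => ⌊1 / ε * (Real.logb 2 n / ε) ^ R *
        polylog (20 * 4 ^ R * (800 * k * A) ^ (R + 1) + A * (R + 1)) ε⌋₊, ?_⟩
    intro n ε hn hε hε1
    have hP := one_le_polylog hA hε hε1
    have hPk : 1 ≤ k * polylog A ε := one_le_mul_of_one_le_of_one_le hk' hP
    have hρ : 0 < ε / (800 * k * polylog A ε) := by positivity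
    have hρ1 : ε / (800 * k * polylog A ε) < 1 := by
      rw [div_lt_one (by positivity)]
      linarith
    refine ⟨⟨hρ, hρ1⟩, fun Q hQ => ?_, ?_⟩
    · obtain ⟨hQn, hQc⟩ := sampleSplittable_queries hQ
      refine ⟨hQn, (Nat.cast_le.2 hQc).trans (Nat.floor_le ?_)⟩
      have h1 : 0 ≤ Real.logb 2 n := Real.logb_nonneg one_lt_two (by exact_mod_cast hn)
      have h2 := one_le_logb_two_div hε hε1
      rw [polylog]
      positivity
    · intro d f T α t ivl hT hTcard hα _ hεα hdesc
      have hn' : (1 : ℝ) ≤ n := by exact_mod_cast hn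
      have hTne : T.Nonempty := by
        have : (0 : ℝ) < T.card := lt_of_lt_of_le (by positivity) hTcard
        exact Finset.card_pos.1 (by exact_mod_cast this)
      have hkn : k ≤ n := le_of_isTupleFamily_nonempty hT hTne
      -- A tuple of `k` distinct indices exists, so n = 1 forces k = 1.
      have hnR : 2 ≤ n ∨ R = 0 := by
        rcases Nat.lt_or_ge n 2 with h | h
        · right
          rw [hR, Nat.log_eq_zero_iff]
          omega
        · exact Or.inl h
      obtain ⟨htk, hlab⟩ := hdesc.2.2.1
      have h800 : 800 * k * (ε / (800 * k * polylog A ε)) = ε / polylog A ε := by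
        field_simp
      have hfind := findsWithHighProb (f := f) (m := Nat.clog 2 n)
        (K := (d * (k + Real.logb 2 (1 / α)) ^ d) ^ k) hk hα hρ (h800.trans_le hεα)
        (Nat.le_pow_clog one_lt_two n) t htk.le hlab
        Unit {()} (fun _ => Finset.Icc 1 n) (fun _ => T) (fun _ => ivl) (Finset.Icc 1 n) R
        (Finset.Icc 1 n) subset_rfl (Finset.nonempty_Icc.2 hn) (by rw [htk])
        (fun _ _ => subset_rfl) (fun _ _ => subset_rfl) (by simp)
        (fun _ _ => by rw [htk]; exact hT) (fun _ _ => hdesc.2.2.2.2) (by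
          rw [Finset.sum_singleton, Nat.card_Icc, Nat.add_sub_cancel]
          refine le_trans ?_ hTcard
          rw [mul_div_right_comm, ← h800]
          gcongr
          norm_num)
      -- 99/100 ≥ 9/10 + 1/20 leaves room for the event of giving up.
      refine successProb_sampleSplittable hρ (b := 1 / 20) (by norm_num) (by norm_num) ?_ ?_
      · rw [sampleHelper_eq_restrictedSample _ subset_rfl, expect_restrictedSample]
        refine le_trans (le_trans (ENNReal.ofReal_le_ofReal ?_) hfind) ?_
        · rw [htk, div_mul_cancel_right₀ (by positivity)]
          norm_num
        · refine expect_mono _ fun A₀ => expect_mono _ fun B => indicator_mono ?_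
          rintro ⟨l, hl, hm, -, hlA, -⟩
          exact ⟨l, hl.trans htk, hm, hlA⟩
      · have h1 := sizeBound_le_queryBound hk hA hε hε1 hnR
        have h2 := h1.trans (Nat.lt_floor_add_one _).le
        linarith
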